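/- Let $d\ge 1$, let $\mathbb{T}=\mathbb{R}/\mathbb{Z}$, and equip $\mathbb{T}^d$ with normalised Lebesgue measure. For $f\in L^1(\mathbb{T}^d)$ (complex-valued) and $n\in\mathbb{Z}^d$ put $\widehat f(n)=\int_{\mathbb{T}^d} f(x)e^{-2\pi i\, n\cdot x}\,dx$. Let $B_0=\{0\}$ and, for $k\ge 1$, $B_k=\{n\in\mathbb{Z}: 2^{k-1}\le |n|\le 2^k-1\}$. For $k_1,\dots,k_d\in\mathbb{N}_0$ define the rough Littlewood–Paley projections $$\Delta_{k_1,\dots,k_d}(f)(x)=\sum_{n\in B_{k_1}\times\cdots\times B_{k_d}}\widehat f(n)\,e^{2\pi i\, n\cdot x},\qquad S(f)=\Big(\sum_{k_1,\dots,k_d\in\mathbb{N}_0}\|\Delta_{k_1,\dots,k_d}(f)\|_{L^\infty(\mathbb{T}^d)}^2\Big)^{1/2}\in[0,\infty].$$ There exist positive constants $c_1(d)$ and $c_2(d)$, depending only on $d$, such that for every $f\in L^1(\mathbb{T}^d)$ with $S(f)<\infty$, $$\int_{\mathbb{T}^d}\exp\Big\{c_1(d)\Big[\frac{|f(x)|}{S(f)}\Big]^{2/d}\Big\}\,dx<c_2(d).$$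 (If $S(f)=0$, then $f=0$ almost everywhere, and the quotient $|f|/S(f)$ is read as $0$.) -/

import Mathlib

open MeasureTheory
open scoped ENNReal

noncomputable section

namespace RoughLP

/-- Normalised Lebesgue (Haar) measure on the torus `𝕋^d = (ℝ/ℤ)^d`; this is the measure with
respect to which Mathlib's `UnitAddTorus.mFourierCoeff` is defined. -/
abbrev torusMeasure (d : ℕ) : Measure (UnitAddTorus (Fin d)) :=
  Measure.pi fun _ : Fin d => (AddCircle.haarAddCircle : Measure UnitAddCircle)

/-- The frequencies of the `k`-th dyadic block: `{0}` for `k = 0`, and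
`{2^(k-1), …, 2^k - 1} ∪ {-2^k + 1, …, -2^(k-1)}` for `k ≥ 1`. -/
def dyadicBlock : ℕ → Finset ℤ
  | 0 => {0}
  | k + 1 => Finset.Icc (2 ^ k) (2 ^ (k + 1) - 1) ∪ Finset.Icc (-2 ^ (k + 1) + 1) (-2 ^ k)

/-- The rough Littlewood–Paley projection `Δ_{k_1,…,k_d} = Δ_{k_1} ⊗ ⋯ ⊗ Δ_{k_d}`: the Fourier
series of `f` restricted to the product of the dyadic blocks of indices `k_1, …, k_d`. -/
def roughProjection {d : ℕ} (k : Fin d → ℕ) (f : UnitAddTorus (Fin d) → ℂ)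
    (x : UnitAddTorus (Fin d)) : ℂ :=
  ∑ n ∈ Fintype.piFinset fun j => dyadicBlock (k j),
    UnitAddTorus.mFourierCoeff f n * UnitAddTorus.mFourier n x

/-- `∑_{k_1,…,k_d ≥ 0} ‖Δ_{k_1,…,k_d} f‖_∞ ^ 2`, as an extended nonnegative real. -/
def roughSquareSum {d : ℕ} (f : UnitAddTorus (Fin d) → ℂ) : ℝ≥0∞ :=
  ∑' k : Fin d → ℕ, eLpNorm (roughProjection k f) ∞ (torusMeasure d) ^ 2

end RoughLP

end

/-! Write `p = 2(m+1)`. Everything rests on the moment bound `‖f‖_p² ≤ (C p)^d S(f)²`, with `C`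
depending only on `d`. Expanding the exponential and using `n^n / n! ≤ e^n` turns it into
exponential integrability of `|f|^{2/d}`.

In one coordinate (`exists_lpNorm_sq_le_sum_coordBlock`), the blocks are added one at a time. If `g`
is the sum of the blocks below `K` and `h` is block `K`, two-smoothness of `L^p`
(`lpNorm_add_sq_le`) gives `‖g+h‖² ≤ ‖g‖² + (linear term) + O(p)‖h‖²`. There is no orthogonality to
kill the linear term `∫ |g|^{p-2} Re(ḡ h)`. Instead `h = τ_v H - H` with `|v| ~ 2^{-K}` and `‖H‖ ≲
‖h‖` (`exists_eq_shift_sub`), and the difference is moved onto `|g|^{p-2} g`. By Bernstein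
(`exists_bernstein`) this costs `p ‖h‖ ∑_{k<K} 2^{k-K} ‖block k‖`, which is summable over `K` by
Schur's test. No boundedness of the rough projections is used: multipliers act only on functions
already localised in a block.

Iterating over the coordinates gives the power `d` (`exists_lpNorm_sq_le_sum`). The bound is proved
for partial sums over dyadic boxes and passes to `f` by Fatou's lemma along an almost everywhere
convergent subsequence. -/

namespace RoughLP

/-! ### Smooth symbols as absolutely convergent trigonometric series -/

open Complex in
/-- The character `t ↦ exp (2πit)` of the real line. -/
noncomputable def expi (t : ℝ) : ℂ := Complex.exp (2 * Real.pi * I * t)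

lemma expi_zero : expi 0 = 1 := by simp [expi]

lemma contDiff_expi : ContDiff ℝ ((⊤ : ℕ∞) : WithTop ℕ∞) expi := by
  unfold expi
  exact (contDiff_const.mul Complex.ofRealCLM.contDiff).cexp

lemma fourier_coe_eq_expi (n : ℤ) (t : ℝ) : fourier n (t : UnitAddCircle) = expi (n * t) := by
  rw [fourier_coe_apply, expi]; congr 1; push_cast; ring

open Real in
/-- A smooth function on the line agrees near the origin with an absolutely convergent
trigonometric series. -/
lemma exists_summable_expi_expansion {ψ : ℝ → ℂ} (hψ : ContDiff ℝ ((⊤ : ℕ∞) : WithTop ℕ∞) ψ) :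
    ∃ c : ℤ → ℂ, Summable (fun l => ‖c l‖) ∧
      ∀ x : ℝ, |x| ≤ 1 / 4 → HasSum (fun l : ℤ => c l * expi (l * x)) (ψ x) := by
  -- The factor `64/5` is `1 / (9/64 - 1/16)`, so `χ` is `1` for `|x| ≤ 1/4` and `0` for `|x| ≥
  -- 3/8`. A nonzero integer translate of a point of `[-1/4, 1/4]` misses the support.
  set χ : ℝ → ℝ := fun x => smoothTransition ((9 / 64 - x ^ 2) * (64 / 5)) with hχ
  have hχs : ContDiff ℝ ((⊤ : ℕ∞) : WithTop ℕ∞) χ :=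
    Real.smoothTransition.contDiff.comp ((contDiff_const.sub (contDiff_id.pow 2)).mul contDiff_const)
  have hχ0 : ∀ x : ℝ, 3 / 8 ≤ |x| → χ x = 0 := by
    intro x hx
    apply smoothTransition.zero_of_nonpos
    have : (3 / 8 : ℝ) ^ 2 ≤ x ^ 2 := by rw [← sq_abs x]; gcongr
    nlinarith
  have hχ1 : ∀ x : ℝ, |x| ≤ 1 / 4 → χ x = 1 := by
    intro x hx
    apply smoothTransition.one_of_one_le
    have : x ^ 2 ≤ (1 / 4 : ℝ) ^ 2 := by rw [← sq_abs x]; gcongr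
    nlinarith
  set g : ℝ → ℂ := fun x => (χ x : ℂ) * ψ x with hg
  have hgs : ContDiff ℝ ((⊤ : ℕ∞) : WithTop ℕ∞) g := (Complex.ofRealCLM.contDiff.comp hχs).mul hψ
  have hgc : HasCompactSupport g := by
    refine HasCompactSupport.intro (isCompact_Icc (a := (-1 : ℝ)) (b := 1)) fun x hx => ?_
    have : 3 / 8 ≤ |x| := by
      by_contra! h
      exact hx ⟨by linarith [(abs_lt.1 h).1], by linarith [(abs_lt.1 h).2]⟩
    simp [hg, hχ0 x this]
  set f := hgc.toSchwartzMap hgs with hf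
  set F := FourierTransform.fourier f with hF
  have hFs : Summable fun n : ℤ => F n :=
    summable_of_isBigO (Real.summable_abs_int_rpow one_lt_two)
      ((F.isBigO_cocompact_rpow (-2)).comp_tendsto Int.tendsto_coe_cofinite)
  refine ⟨fun l => F l, hFs.norm, fun x hx => ?_⟩
  have hs : Summable fun l : ℤ => F l * expi (l * x) := by
    refine Summable.of_norm ?_
    refine hFs.norm.congr fun l => ?_
    rw [norm_mul, expi, show (2 * Real.pi * Complex.I * ((l * x : ℝ) : ℂ)) =
      ((2 * Real.pi * (l * x) : ℝ) : ℂ) * Complex.I by push_cast; ring,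
      Complex.norm_exp_ofReal_mul_I, mul_one]
  convert hs.hasSum using 1
  -- Poisson summation: the series is the periodisation of `g` at `x`, of which only the term `n =
  -- 0` survives.
  have := SchwartzMap.tsum_eq_tsum_fourier f x
  simp_rw [fourier_coe_eq_expi] at this
  rw [← this, tsum_eq_single 0]
  · simp [hf, hg, hχ1 x hx]
  · intro n hn
    have h1 : (1 : ℝ) ≤ |(n : ℝ)| := by exact_mod_cast Int.one_le_abs hn
    have : 3 / 8 ≤ |x + n| := by
      have := abs_sub_abs_le_abs_sub (n : ℝ) (-x)
      rw [abs_neg, sub_neg_eq_add, add_comm (n : ℝ)] at this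
      linarith
    simp [hf, hg, hχ0 _ this]

/-- Lets the reciprocal of `expi x - 1` be written as its conjugate over a real denominator, which
can then be modified to be nonvanishing. -/
lemma normSq_expi_sub_one (x : ℝ) :
    (expi x - 1) * (starRingEnd ℂ) (expi x - 1) = ((2 - 2 * Real.cos (2 * Real.pi * x) : ℝ) : ℂ) := by
  have h : expi x = (Real.cos (2 * Real.pi * x) : ℂ) + Real.sin (2 * Real.pi * x) * Complex.I := by
    rw [expi, show (2 * Real.pi * Complex.I * (x : ℂ)) =
      ((2 * Real.pi * x : ℝ) : ℂ) * Complex.I by push_cast; ring, Complex.exp_mul_I]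
    push_cast; rfl
  rw [Complex.mul_conj, h, ← Complex.ofReal_one]
  congr 1
  rw [Complex.normSq_apply]
  simp only [Complex.sub_re, Complex.add_re, Complex.ofReal_re, Complex.mul_re, Complex.I_re,
    Complex.ofReal_im, Complex.I_im, Complex.sub_im, Complex.add_im, Complex.mul_im]
  nlinarith [Real.sin_sq_add_cos_sq (2 * Real.pi * x)]

open Real in
/-- There is a smooth function agreeing with `1 / (exp (2πix) - 1)` on `1/8 ≤ |x| ≤ 1/4`. -/
lemma exists_smooth_inverse_expi_sub_one :
    ∃ ψ : ℝ → ℂ, ContDiff ℝ ((⊤ : ℕ∞) : WithTop ℕ∞) ψ ∧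
      ∀ x : ℝ, 1 / 8 ≤ |x| → |x| ≤ 1 / 4 → ψ x * (expi x - 1) = 1 := by
  -- `η` vanishes exactly on `1/8 ≤ |x| ≤ 1/4`, so adding it removes the zeros of `2 - 2 cos (2πx)`
  -- without changing it on that set.
  set η : ℝ → ℝ := fun x => smoothTransition (1 / 64 - x ^ 2) + smoothTransition (x ^ 2 - 1 / 16)
    with hη
  set D : ℝ → ℝ := fun x => (2 - 2 * Real.cos (2 * Real.pi * x)) + η x with hD
  have hηs : ContDiff ℝ ((⊤ : ℕ∞) : WithTop ℕ∞) η :=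
    (smoothTransition.contDiff.comp (contDiff_const.sub (contDiff_id.pow 2))).add
      (smoothTransition.contDiff.comp ((contDiff_id.pow 2).sub contDiff_const))
  have hDs : ContDiff ℝ ((⊤ : ℕ∞) : WithTop ℕ∞) D := by
    refine ContDiff.add (contDiff_const.sub (contDiff_const.mul ?_)) hηs
    exact Real.contDiff_cos.comp (contDiff_const.mul contDiff_id)
  have hη_nonneg : ∀ x, 0 ≤ η x := fun x =>
    add_nonneg (smoothTransition.nonneg _) (smoothTransition.nonneg _)
  have hcos : ∀ x : ℝ, 1 / 8 ≤ |x| → |x| ≤ 1 / 4 → Real.cos (2 * Real.pi * x) < 1 := by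
    intro x h1 h2
    rw [← Real.cos_abs, abs_mul, abs_of_pos (by positivity : (0:ℝ) < 2 * π), ← Real.cos_zero]
    apply Real.cos_lt_cos_of_nonneg_of_le_pi le_rfl <;> nlinarith [Real.pi_pos]
  have hDpos : ∀ x, D x ≠ 0 := by
    intro x
    have h1 : 0 ≤ 2 - 2 * Real.cos (2 * Real.pi * x) := by
      linarith [Real.cos_le_one (2 * Real.pi * x)]
    apply ne_of_gt
    by_cases hx : 1 / 8 ≤ |x| ∧ |x| ≤ 1 / 4
    · have := hcos x hx.1 hx.2
      have := hη_nonneg x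
      simp only [hD]; linarith
    · have : 0 < η x := by
        rw [not_and_or, not_le, not_le] at hx
        rcases hx with hx | hx
        · refine add_pos_of_pos_of_nonneg (smoothTransition.pos_of_pos ?_) (smoothTransition.nonneg _)
          have : x ^ 2 < (1 / 8 : ℝ) ^ 2 := by rw [← sq_abs x]; gcongr
          linarith
        · refine add_pos_of_nonneg_of_pos (smoothTransition.nonneg _) (smoothTransition.pos_of_pos ?_)
          have : (1 / 4 : ℝ) ^ 2 < x ^ 2 := by rw [← sq_abs x]; gcongr
          linarith
      simp only [hD]; linarith
  refine ⟨fun x => (starRingEnd ℂ) (expi x - 1) * (((D x)⁻¹ : ℝ) : ℂ), ?_, fun x h1 h2 => ?_⟩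
  · refine ContDiff.mul ?_ (Complex.ofRealCLM.contDiff.comp (hDs.inv hDpos))
    exact Complex.conjCLE.contDiff.comp (contDiff_expi.sub contDiff_const)
  · have hη0 : η x = 0 := by
      have h3 : (1 / 8 : ℝ) ^ 2 ≤ x ^ 2 := by rw [← sq_abs x]; gcongr
      have h4 : x ^ 2 ≤ (1 / 4 : ℝ) ^ 2 := by rw [← sq_abs x]; gcongr
      simp only [hη]
      rw [smoothTransition.zero_of_nonpos (by linarith), smoothTransition.zero_of_nonpos (by linarith),
        add_zero]
    have hDx : D x = 2 - 2 * Real.cos (2 * Real.pi * x) := by simp [hD, hη0]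
    rw [mul_right_comm, mul_comm ((starRingEnd ℂ) _), normSq_expi_sub_one, ← hDx,
      ← Complex.ofReal_mul, mul_inv_cancel₀ (hDpos x), Complex.ofReal_one]

/-! ### Numerical inequalities behind two-smoothness -/

lemma abs_pow_sub_pow_le {x y : ℝ} (hx : 0 ≤ x) (hy : 0 ≤ y) (n : ℕ) :
    |x ^ (n + 1) - y ^ (n + 1)| ≤ (n + 1) * (max x y) ^ n * |x - y| := by
  have hM : 0 ≤ max x y := le_max_of_le_left hx
  induction n with
  | zero => simp
  | succ n ih =>
    have h : x ^ (n + 1 + 1) - y ^ (n + 1 + 1) = x ^ (n + 1) * (x - y) + y * (x ^ (n + 1) - y ^ (n + 1)) := by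
      ring
    rw [h]
    refine (abs_add_le _ _).trans ?_
    rw [abs_mul, abs_mul, abs_of_nonneg (pow_nonneg hx _), abs_of_nonneg hy]
    have h1 : x ^ (n + 1) * |x - y| ≤ (max x y) ^ (n + 1) * |x - y| := by
      gcongr; exact le_max_left _ _
    have h2 : y * |x ^ (n + 1) - y ^ (n + 1)| ≤ max x y * ((n + 1) * (max x y) ^ n * |x - y|) := by
      gcongr; exact le_max_right _ _
    calc _ ≤ _ := add_le_add h1 h2
      _ = _ := by push_cast; ring

/-- The map `z ↦ |z|ⁿ z` is Lipschitz on balls. -/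
lemma norm_pow_mul_sub_le (a b : ℂ) (n : ℕ) :
    ‖(‖a‖ ^ n : ℝ) * a - (‖b‖ ^ n : ℝ) * b‖ ≤ (n + 1) * (‖a‖ ^ n + ‖b‖ ^ n) * ‖a - b‖ := by
  have hmax : (max ‖a‖ ‖b‖) ^ n ≤ ‖a‖ ^ n + ‖b‖ ^ n := by
    rcases max_choice ‖a‖ ‖b‖ with h | h <;> rw [h] <;> simp
  suffices h : ‖(‖a‖ ^ n : ℝ) * a - (‖b‖ ^ n : ℝ) * b‖ ≤ (n + 1) * (max ‖a‖ ‖b‖) ^ n * ‖a - b‖ by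
    refine h.trans ?_; gcongr
  have e : (‖a‖ ^ n : ℝ) * a - (‖b‖ ^ n : ℝ) * b =
      (‖a‖ ^ n : ℝ) * (a - b) + ((‖a‖ ^ n - ‖b‖ ^ n : ℝ) : ℂ) * b := by push_cast; ring
  rw [e]
  refine (norm_add_le _ _).trans ?_
  rw [norm_mul, norm_mul, Complex.norm_real, Complex.norm_real, Real.norm_eq_abs, Real.norm_eq_abs,
    abs_of_nonneg (by positivity)]
  have hab : |‖a‖ - ‖b‖| ≤ ‖a - b‖ := abs_norm_sub_norm_le a b
  have h1 : ‖a‖ ^ n * ‖a - b‖ ≤ (max ‖a‖ ‖b‖) ^ n * ‖a - b‖ := by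
    gcongr; exact le_max_left _ _
  rcases n with _ | n
  · simp at h1 ⊢
  have h2 : |‖a‖ ^ (n + 1) - ‖b‖ ^ (n + 1)| * ‖b‖ ≤
      ((n + 1) * (max ‖a‖ ‖b‖) ^ n * ‖a - b‖) * max ‖a‖ ‖b‖ := by
    gcongr
    · exact (abs_pow_sub_pow_le (norm_nonneg _) (norm_nonneg _) n).trans (by gcongr)
    · exact le_max_right _ _
  calc _ ≤ _ := add_le_add h1 h2
    _ = _ := by push_cast; ring

/-- Second order Taylor upper bound for `t ↦ t ^ m` on `[0, M]`. -/
lemma add_pow_le_taylor {s u M : ℝ} (hs : 0 ≤ s) (hsu : 0 ≤ s + u) (hsM : s ≤ M) (huM : s + u ≤ M)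
    (m : ℕ) : (s + u) ^ (m + 1) ≤ s ^ (m + 1) + (m + 1) * s ^ m * u +
      (m + 1) * m / 2 * (M ^ (m - 1) * u ^ 2) := by
  have hM : 0 ≤ M := hs.trans hsM
  induction m with
  | zero => simp
  | succ m ih =>
    have h1 := mul_le_mul_of_nonneg_left ih hsu
    have h2 : s ^ m ≤ M ^ m := by gcongr
    have h3 : (s + u) * ((m + 1) * m / 2 * (M ^ (m - 1) * u ^ 2)) ≤
        (m + 1) * m / 2 * (M ^ m * u ^ 2) := by
      rcases m with _ | m
      · simp
      · have : (s + u) * (M ^ m * u ^ 2) ≤ M * (M ^ m * u ^ 2) := by gcongr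
        calc _ = (((m + 1 : ℕ) + 1) * (m + 1 : ℕ) / 2 : ℝ) * ((s + u) * (M ^ m * u ^ 2)) := by
              rw [Nat.add_sub_cancel]; push_cast; ring
          _ ≤ (((m + 1 : ℕ) + 1) * (m + 1 : ℕ) / 2 : ℝ) * (M * (M ^ m * u ^ 2)) := by gcongr
          _ = _ := by ring
    have h4 : ((m : ℝ) + 1) * (s ^ m * u ^ 2) ≤ (m + 1) * (M ^ m * u ^ 2) := by gcongr
    calc (s + u) ^ (m + 1 + 1) = (s + u) * (s + u) ^ (m + 1) := by ring
      _ ≤ (s + u) * (s ^ (m + 1) + (m + 1) * s ^ m * u) +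
          (m + 1) * m / 2 * (M ^ m * u ^ 2) := by linarith
      _ = s ^ (m + 1 + 1) + (m + 1 + 1) * s ^ (m + 1) * u + (m + 1) * (s ^ m * u ^ 2) +
          (m + 1) * m / 2 * (M ^ m * u ^ 2) := by ring
      _ ≤ s ^ (m + 1 + 1) + (m + 1 + 1) * s ^ (m + 1) * u + (m + 1) * (M ^ m * u ^ 2) +
          (m + 1) * m / 2 * (M ^ m * u ^ 2) := by linarith
      _ = _ := by rw [Nat.add_sub_cancel]; push_cast; ring

/-- Taylor expansion of `t ↦ t^(m+1)` at `|a|²` with increment `2 Re(ā b) + |b|²`, whose square is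
at most `4|b|²(|a|+|b|)²`. The remainder has size `p²`; one factor `p` disappears on returning to
squares of norms. -/
lemma norm_add_pow_le (a b : ℂ) (m : ℕ) :
    ‖a + b‖ ^ (2 * (m + 1)) ≤ ‖a‖ ^ (2 * (m + 1)) +
      2 * (m + 1) * (‖a‖ ^ (2 * m) * ((starRingEnd ℂ) a * b).re) +
      2 * (m + 1) ^ 2 * ((‖a‖ + ‖b‖) ^ (2 * m) * ‖b‖ * ‖b‖) := by
  set r := ((starRingEnd ℂ) a * b).re with hr
  have hre : |r| ≤ ‖a‖ * ‖b‖ := by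
    refine (Complex.abs_re_le_norm _).trans ?_
    rw [norm_mul, RCLike.norm_conj]
  have hexp : ‖a + b‖ ^ 2 = ‖a‖ ^ 2 + (2 * r + ‖b‖ ^ 2) := by
    rw [← Complex.normSq_eq_norm_sq, ← Complex.normSq_eq_norm_sq, ← Complex.normSq_eq_norm_sq,
      Complex.normSq_add, hr]
    have : (a * (starRingEnd ℂ) b).re = ((starRingEnd ℂ) a * b).re := by
      simp [Complex.mul_re]
    rw [this]; ring
  have hA : 0 ≤ ‖a‖ := norm_nonneg a
  have hB : 0 ≤ ‖b‖ := norm_nonneg b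
  obtain ⟨hr1, hr2⟩ := abs_le.1 hre
  have hT := add_pow_le_taylor (s := ‖a‖ ^ 2) (u := 2 * r + ‖b‖ ^ 2) (M := (‖a‖ + ‖b‖) ^ 2)
    (by positivity) (by rw [← hexp]; positivity) (by nlinarith) (by nlinarith) m
  rw [← hexp, ← pow_mul, ← pow_mul, ← pow_mul, ← pow_mul] at hT
  have hu : (2 * r + ‖b‖ ^ 2) ^ 2 ≤ 4 * (‖b‖ ^ 2 * (‖a‖ + ‖b‖) ^ 2) := by
    have : |2 * r + ‖b‖ ^ 2| ≤ 2 * (‖b‖ * (‖a‖ + ‖b‖)) := by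
      rw [abs_le]; constructor <;> nlinarith
    calc (2 * r + ‖b‖ ^ 2) ^ 2 = |2 * r + ‖b‖ ^ 2| ^ 2 := (sq_abs _).symm
      _ ≤ (2 * (‖b‖ * (‖a‖ + ‖b‖))) ^ 2 := by gcongr
      _ = _ := by ring
  have h1 : ‖a‖ ^ (2 * m) * ‖b‖ ^ 2 ≤ (‖a‖ + ‖b‖) ^ (2 * m) * ‖b‖ ^ 2 := by
    gcongr; linarith
  have h2 : ((m : ℝ) + 1) * m / 2 * ((‖a‖ + ‖b‖) ^ (2 * (m - 1)) * (2 * r + ‖b‖ ^ 2) ^ 2) ≤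
      2 * ((m + 1) * m) * ((‖a‖ + ‖b‖) ^ (2 * m) * ‖b‖ ^ 2) := by
    rcases m with _ | m
    · simp
    · simp only [Nat.add_sub_cancel]
      calc _ ≤ (((m + 1 : ℕ) : ℝ) + 1) * (m + 1 : ℕ) / 2 * ((‖a‖ + ‖b‖) ^ (2 * m) *
            (4 * (‖b‖ ^ 2 * (‖a‖ + ‖b‖) ^ 2))) := by gcongr
        _ = _ := by ring
  have hX : 0 ≤ (‖a‖ + ‖b‖) ^ (2 * m) * ‖b‖ ^ 2 := by positivity
  have hm : (0 : ℝ) ≤ m := m.cast_nonneg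
  calc _ ≤ _ := hT
    _ ≤ ‖a‖ ^ (2 * (m + 1)) + 2 * (m + 1) * (‖a‖ ^ (2 * m) * r)
        + ((m + 1) * (‖a‖ ^ (2 * m) * ‖b‖ ^ 2) +
        2 * ((m + 1) * m) * ((‖a‖ + ‖b‖) ^ (2 * m) * ‖b‖ ^ 2)) := by
        linarith
    _ ≤ ‖a‖ ^ (2 * (m + 1)) + 2 * (m + 1) * (‖a‖ ^ (2 * m) * r)
        + ((m + 1) * ((‖a‖ + ‖b‖) ^ (2 * m) * ‖b‖ ^ 2) +
        2 * ((m + 1) * m) * ((‖a‖ + ‖b‖) ^ (2 * m) * ‖b‖ ^ 2)) := by gcongr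
    _ ≤ _ := by nlinarith

/-- Passing from a bound for `2m`-th powers to a bound for squares. -/
lemma sq_le_of_pow_le {N G b Λ : ℝ} (hN : 0 ≤ N) (hG : 0 ≤ G) (hb : 0 ≤ b) (hΛ : 0 ≤ Λ)
    (hNG : N ≤ G + b) (m : ℕ)
    (h : N ^ (2 * (m + 1)) ≤ G ^ (2 * (m + 1)) + 2 * (m + 1) * (Λ * G ^ (2 * m)) +
      2 * (m + 1) ^ 2 * ((G + b) ^ (2 * m) * b ^ 2)) :
    N ^ 2 ≤ G ^ 2 + 2 * Λ + 6 * (m + 1) * b ^ 2 := by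
  have hm : (0 : ℝ) ≤ m := m.cast_nonneg
  -- If `b ≤ G/p`, then `(G+b)^(2m) ≤ e G^(2m)`, so the remainder is absorbed by Bernoulli's
  -- inequality. Otherwise `G < p b`, and `(G+b)²` alone is small enough.
  rcases le_or_gt (2 * (m + 1) * b) G with hc | hc
  · have hpow : (G + b) ^ (2 * m) ≤ 3 * G ^ (2 * m) := by
      have h1 : G + b ≤ G * (1 + 1 / (2 * (m + 1))) := by
        have : b ≤ G / (2 * (m + 1)) := by rw [le_div_iff₀ (by positivity)]; linarith
        calc G + b ≤ G + G / (2 * (m + 1)) := by linarith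
          _ = _ := by ring
      have h2 : (1 + 1 / (2 * ((m : ℝ) + 1))) ^ (2 * m) ≤ 3 := by
        have h3 : (1 + 1 / (2 * ((m : ℝ) + 1))) ≤ Real.exp (1 / (2 * ((m : ℝ) + 1))) := by
          linarith [Real.add_one_le_exp (1 / (2 * ((m : ℝ) + 1)))]
        calc _ ≤ Real.exp (1 / (2 * ((m : ℝ) + 1))) ^ (2 * m) := by gcongr
          _ = Real.exp ((2 * m : ℕ) * (1 / (2 * ((m : ℝ) + 1)))) := (Real.exp_nat_mul _ _).symm
          _ ≤ Real.exp 1 := by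
            apply Real.exp_le_exp.2
            push_cast
            rw [mul_one_div, div_le_one (by positivity)]; linarith
          _ ≤ 3 := by linarith [Real.exp_one_lt_d9]
      calc (G + b) ^ (2 * m) ≤ (G * (1 + 1 / (2 * (m + 1)))) ^ (2 * m) := by gcongr
        _ = (1 + 1 / (2 * ((m : ℝ) + 1))) ^ (2 * m) * G ^ (2 * m) := by rw [mul_pow]; ring
        _ ≤ _ := by gcongr
    have hbern : ∀ s u : ℝ, 0 ≤ s → 0 ≤ u → s ^ (m + 1) + (m + 1) * s ^ m * u ≤ (s + u) ^ (m + 1) := by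
      intro s u hs hu
      clear h hpow hc
      induction m with
      | zero => simp
      | succ m ih =>
        have := mul_le_mul_of_nonneg_left (ih (by positivity)) (add_nonneg hs hu)
        have h5 : 0 ≤ ((m : ℝ) + 1) * s ^ m * u * u := by positivity
        calc _ ≤ (s + u) * (s ^ (m + 1) + (m + 1) * s ^ m * u) := by
              push_cast; ring_nf at h5 ⊢; linarith
          _ ≤ _ := this
          _ = _ := by ring
    -- The linear term of this expansion matches exactly: `6(m+1)b²` is `2(m+1)b²` times the bound
    -- `3` in `hpow`.
    have h6 := hbern (G ^ 2) (2 * Λ + 6 * (m + 1) * b ^ 2) (by positivity) (by positivity)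
    rw [← pow_mul, ← pow_mul] at h6
    have h7 : (N ^ 2) ^ (m + 1) ≤ (G ^ 2 + (2 * Λ + 6 * (m + 1) * b ^ 2)) ^ (m + 1) := by
      rw [← pow_mul]
      refine h.trans (le_trans ?_ h6)
      have h8 : 2 * ((m : ℝ) + 1) ^ 2 * ((G + b) ^ (2 * m) * b ^ 2) ≤
          2 * (m + 1) ^ 2 * ((3 * G ^ (2 * m)) * b ^ 2) := by gcongr
      calc _ ≤ G ^ (2 * (m + 1)) + 2 * (m + 1) * (Λ * G ^ (2 * m)) +
            2 * (m + 1) ^ 2 * ((3 * G ^ (2 * m)) * b ^ 2) := by linarith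
        _ = _ := by ring
    have := (pow_le_pow_iff_left₀ (by positivity) (by positivity) (Nat.succ_ne_zero m)).1 h7
    linarith
  · have h1 : N ^ 2 ≤ (G + b) ^ 2 := by gcongr
    have h2 : G * b ≤ 2 * (m + 1) * b * b := by gcongr
    nlinarith [mul_nonneg hm (sq_nonneg b), sq_nonneg b]

/-- Schur's test for the kernel `2 ^ (k - K)`, `k < K`. -/
lemma sum_mul_geometric_le (b : ℕ → ℝ) (N : ℕ) :
    ∑ K ∈ Finset.range N, b K * ∑ k ∈ Finset.range K, (1 / 2 : ℝ) ^ (K - k) * b k ≤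
      ∑ K ∈ Finset.range N, b K ^ 2 := by
  have hgeo : ∀ n : ℕ, ∑ i ∈ Finset.range n, (1 / 2 : ℝ) ^ (i + 1) ≤ 1 := by
    intro n
    have : ∑ i ∈ Finset.range n, (1 / 2 : ℝ) ^ (i + 1) = 1 - (1 / 2) ^ n := by
      induction n with
      | zero => simp
      | succ n ih => rw [Finset.sum_range_succ, ih]; ring
    rw [this]; linarith [pow_pos (by norm_num : (0:ℝ) < 1 / 2) n]
  have h1 : ∀ K, ∑ k ∈ Finset.range K, (1 / 2 : ℝ) ^ (K - k) ≤ 1 := by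
    intro K
    rw [← Finset.sum_range_reflect]
    refine le_trans (le_of_eq (Finset.sum_congr rfl fun i hi => ?_)) (hgeo K)
    have := Finset.mem_range.1 hi
    congr 1; omega
  have h2 : ∀ k, ∑ K ∈ Finset.Ico (k + 1) N, (1 / 2 : ℝ) ^ (K - k) ≤ 1 := by
    intro k
    rw [Finset.sum_Ico_eq_sum_range]
    refine le_trans (le_of_eq (Finset.sum_congr rfl fun i hi => ?_)) (hgeo (N - (k + 1)))
    congr 1; omega
  have hA : ∑ K ∈ Finset.range N, ∑ k ∈ Finset.range K, (1 / 2 : ℝ) ^ (K - k) * b K ^ 2 ≤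
      ∑ K ∈ Finset.range N, b K ^ 2 := by
    refine Finset.sum_le_sum fun K _ => ?_
    rw [← Finset.sum_mul]
    exact mul_le_of_le_one_left (sq_nonneg _) (h1 K)
  have hB : ∑ K ∈ Finset.range N, ∑ k ∈ Finset.range K, (1 / 2 : ℝ) ^ (K - k) * b k ^ 2 ≤
      ∑ K ∈ Finset.range N, b K ^ 2 := by
    rw [Finset.sum_comm' (t' := Finset.range N) (s' := fun k => Finset.Ico (k + 1) N)
      (by intro x y; simp only [Finset.mem_range, Finset.mem_Ico]; omega)]
    refine Finset.sum_le_sum fun k _ => ?_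
    rw [← Finset.sum_mul]
    exact mul_le_of_le_one_left (sq_nonneg _) (h2 k)
  calc _ ≤ ∑ K ∈ Finset.range N, ∑ k ∈ Finset.range K,
        ((1 / 2 : ℝ) ^ (K - k) * b K ^ 2 + (1 / 2 : ℝ) ^ (K - k) * b k ^ 2) / 2 := by
        refine Finset.sum_le_sum fun K _ => ?_
        rw [Finset.mul_sum]
        refine Finset.sum_le_sum fun k _ => ?_
        have : 0 ≤ (1 / 2 : ℝ) ^ (K - k) := by positivity
        nlinarith [mul_nonneg this (sq_nonneg (b K - b k))]
    _ = (∑ K ∈ Finset.range N, ∑ k ∈ Finset.range K, (1 / 2 : ℝ) ^ (K - k) * b K ^ 2 +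
        ∑ K ∈ Finset.range N, ∑ k ∈ Finset.range K, (1 / 2 : ℝ) ^ (K - k) * b k ^ 2) / 2 := by
        simp_rw [← Finset.sum_div, Finset.sum_add_distrib]
    _ ≤ _ := by linarith

/-! ### Norms with even exponent and Hölder's inequality -/

/-- The even exponent `2 (m + 1)`. -/
noncomputable def evenExp (m : ℕ) : ℝ≥0∞ := ((2 * (m + 1) : ℕ) : ℝ≥0∞)

instance fact_one_le_evenExp (m : ℕ) : Fact (1 ≤ evenExp m) :=
  ⟨by unfold evenExp; exact_mod_cast (by omega : 1 ≤ 2 * (m + 1))⟩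

lemma evenExp_ne_top (m : ℕ) : evenExp m ≠ ∞ := ENNReal.natCast_ne_top _

lemma evenExp_ne_zero (m : ℕ) : evenExp m ≠ 0 :=
  (zero_lt_one.trans_le (fact_one_le_evenExp m).out).ne'

lemma evenExp_toReal (m : ℕ) : (evenExp m).toReal = 2 * ((m : ℝ) + 1) := by
  unfold evenExp; rw [ENNReal.toReal_natCast]; push_cast; ring

variable {d : ℕ}

/-- The `L^{2(m+1)}` norm of a continuous function on the torus. -/
noncomputable def lpNorm (m : ℕ) (f : C(UnitAddTorus (Fin d), ℂ)) : ℝ :=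
  ‖ContinuousMap.toLp (E := ℂ) (evenExp m) (torusMeasure d) ℂ f‖

lemma lpNorm_nonneg (m : ℕ) (f : C(UnitAddTorus (Fin d), ℂ)) : 0 ≤ lpNorm m f := norm_nonneg _

lemma lpNorm_add_le (m : ℕ) (f g : C(UnitAddTorus (Fin d), ℂ)) :
    lpNorm m (f + g) ≤ lpNorm m f + lpNorm m g := by
  unfold lpNorm; rw [map_add]; exact norm_add_le _ _

lemma lpNorm_zero (m : ℕ) : lpNorm m (0 : C(UnitAddTorus (Fin d), ℂ)) = 0 := by
  unfold lpNorm; rw [map_zero, norm_zero]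

lemma lpNorm_sum_le {ι : Type*} (m : ℕ) (s : Finset ι) (f : ι → C(UnitAddTorus (Fin d), ℂ)) :
    lpNorm m (∑ i ∈ s, f i) ≤ ∑ i ∈ s, lpNorm m (f i) := by
  unfold lpNorm; rw [map_sum]; exact norm_sum_le _ _

lemma ofReal_lpNorm_eq_eLpNorm (m : ℕ) (f : C(UnitAddTorus (Fin d), ℂ)) :
    ENNReal.ofReal (lpNorm m f) = eLpNorm f (evenExp m) (torusMeasure d) := by
  rw [lpNorm, Lp.norm_def, ENNReal.ofReal_toReal (Lp.eLpNorm_ne_top _)]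
  exact eLpNorm_congr_ae (ContinuousMap.coeFn_toLp _ f)

lemma ofReal_lpNorm (m : ℕ) (f : C(UnitAddTorus (Fin d), ℂ)) :
    ENNReal.ofReal (lpNorm m f) =
      (∫⁻ x, ‖f x‖ₑ ^ (2 * (m + 1)) ∂(torusMeasure d)) ^ (1 / (2 * ((m : ℝ) + 1))) := by
  rw [ofReal_lpNorm_eq_eLpNorm,
    eLpNorm_eq_lintegral_rpow_enorm_toReal (evenExp_ne_zero m) (evenExp_ne_top m), evenExp_toReal]
  congr 1
  refine lintegral_congr fun x => ?_
  rw [← ENNReal.rpow_natCast]; congr 1; push_cast; ring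

lemma ofReal_lpNorm_pow (m : ℕ) (f : C(UnitAddTorus (Fin d), ℂ)) :
    ENNReal.ofReal (lpNorm m f) ^ (2 * (m + 1)) =
      ∫⁻ x, ‖f x‖ₑ ^ (2 * (m + 1)) ∂(torusMeasure d) := by
  rw [ofReal_lpNorm, ← ENNReal.rpow_natCast, ← ENNReal.rpow_mul]
  have : (1 / (2 * ((m : ℝ) + 1))) * ((2 * (m + 1) : ℕ) : ℝ) = 1 := by
    push_cast; field_simp
  rw [this, ENNReal.rpow_one]

lemma integrable_continuousMap {E : Type*} [NormedAddCommGroup E] {g : UnitAddTorus (Fin d) → E}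
    (hg : Continuous g) : Integrable g (torusMeasure d) :=
  hg.integrable_of_hasCompactSupport (HasCompactSupport.of_compactSpace g)

lemma lpNorm_pow (m : ℕ) (f : C(UnitAddTorus (Fin d), ℂ)) :
    lpNorm m f ^ (2 * (m + 1)) = ∫ x, ‖f x‖ ^ (2 * (m + 1)) ∂(torusMeasure d) := by
  rw [integral_eq_lintegral_of_nonneg_ae (ae_of_all _ fun x => by positivity)
    ((by fun_prop : Continuous fun x => ‖f x‖ ^ (2 * (m + 1))).aestronglyMeasurable)]
  have : ∀ x, ENNReal.ofReal (‖f x‖ ^ (2 * (m + 1))) = ‖f x‖ₑ ^ (2 * (m + 1)) := fun x => by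
    rw [ENNReal.ofReal_pow (norm_nonneg _), ofReal_norm]
  simp_rw [this]
  rw [← ofReal_lpNorm_pow, ENNReal.toReal_pow, ENNReal.toReal_ofReal (lpNorm_nonneg _ _)]

lemma lpNorm_mono {m : ℕ} {f g : C(UnitAddTorus (Fin d), ℂ)} (h : ∀ x, ‖f x‖ ≤ ‖g x‖) :
    lpNorm m f ≤ lpNorm m g := by
  rw [← ENNReal.ofReal_le_ofReal_iff (lpNorm_nonneg _ _), ofReal_lpNorm_eq_eLpNorm,
    ofReal_lpNorm_eq_eLpNorm]
  exact eLpNorm_mono h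

/-- Hölder's inequality for three functions with exponents `p / (p - 2)`, `p`, `p`. -/
lemma integral_pow_mul_mul_le (m : ℕ) (u v w : C(UnitAddTorus (Fin d), ℂ)) :
    ∫ x, ‖u x‖ ^ (2 * m) * ‖v x‖ * ‖w x‖ ∂(torusMeasure d) ≤
      lpNorm m u ^ (2 * m) * lpNorm m v * lpNorm m w := by
  have hm : (0 : ℝ) < (m : ℝ) + 1 := by positivity
  rw [integral_eq_lintegral_of_nonneg_ae (ae_of_all _ fun x => by positivity)
    ((by fun_prop : Continuous fun x => ‖u x‖ ^ (2 * m) * ‖v x‖ * ‖w x‖).aestronglyMeasurable)]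
  refine ENNReal.toReal_le_of_le_ofReal
    (by have := lpNorm_nonneg m u; have := lpNorm_nonneg m v; have := lpNorm_nonneg m w; positivity) ?_
  rw [ENNReal.ofReal_mul (by have := lpNorm_nonneg m u; have := lpNorm_nonneg m v; positivity),
    ENNReal.ofReal_mul (by have := lpNorm_nonneg m u; positivity),
    ENNReal.ofReal_pow (lpNorm_nonneg m u)]
  have key := ENNReal.lintegral_prod_norm_pow_le (μ := torusMeasure d) (Finset.univ : Finset (Fin 3))
    (f := ![fun x => ‖u x‖ₑ ^ (2 * (m + 1)), fun x => ‖v x‖ₑ ^ (2 * (m + 1)),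
      fun x => ‖w x‖ₑ ^ (2 * (m + 1))])
    -- The weights sum to `1`; for `m = 0` the first is zero and this is Cauchy–Schwarz.
    (p := ![m / ((m : ℝ) + 1), 1 / (2 * ((m : ℝ) + 1)), 1 / (2 * ((m : ℝ) + 1))])
    (by
      intro i _
      fin_cases i
      · exact (by fun_prop : Continuous fun x => ‖u x‖ₑ ^ (2 * (m + 1))).aemeasurable
      · exact (by fun_prop : Continuous fun x => ‖v x‖ₑ ^ (2 * (m + 1))).aemeasurable
      · exact (by fun_prop : Continuous fun x => ‖w x‖ₑ ^ (2 * (m + 1))).aemeasurable)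
    (by simp [Fin.sum_univ_three]; field_simp; ring)
    (by intro i _; fin_cases i <;> simp <;> positivity)
  simp only [Fin.prod_univ_three, Matrix.cons_val_zero, Matrix.cons_val_one, Matrix.cons_val] at key
  rw [ofReal_lpNorm m v, ofReal_lpNorm m w]
  have hu : ENNReal.ofReal (lpNorm m u) ^ (2 * m) =
      (∫⁻ x, ‖u x‖ₑ ^ (2 * (m + 1)) ∂(torusMeasure d)) ^ (m / ((m : ℝ) + 1)) := by
    rw [← ofReal_lpNorm_pow, ← ENNReal.rpow_natCast, ← ENNReal.rpow_natCast, ← ENNReal.rpow_mul]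
    congr 1; push_cast; field_simp
  rw [hu]
  refine le_trans (le_of_eq (lintegral_congr fun x => ?_)) key
  have e1 : ∀ z : ℂ, (‖z‖ₑ ^ (2 * (m + 1))) ^ (1 / (2 * ((m : ℝ) + 1))) = ‖z‖ₑ := fun z => by
    rw [← ENNReal.rpow_natCast, ← ENNReal.rpow_mul]
    have : ((2 * (m + 1) : ℕ) : ℝ) * (1 / (2 * ((m : ℝ) + 1))) = 1 := by push_cast; field_simp
    rw [this, ENNReal.rpow_one]
  have e2 : ∀ z : ℂ, (‖z‖ₑ ^ (2 * (m + 1))) ^ (m / ((m : ℝ) + 1)) = ‖z‖ₑ ^ (2 * m) := fun z => by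
    rw [← ENNReal.rpow_natCast, ← ENNReal.rpow_mul, ← ENNReal.rpow_natCast]
    congr 1; push_cast; field_simp
  rw [e1, e1, e2, ENNReal.ofReal_mul (by positivity), ENNReal.ofReal_mul (by positivity),
    ENNReal.ofReal_pow (norm_nonneg _)]
  simp_rw [ofReal_norm]

/-! ### Translations, duality and two-smoothness -/

/-- Translation of a continuous function on the torus. -/
noncomputable def translate (v : UnitAddTorus (Fin d)) (f : C(UnitAddTorus (Fin d), ℂ)) :
    C(UnitAddTorus (Fin d), ℂ) := f.comp ⟨fun x => x + v, by fun_prop⟩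

lemma translate_apply (v : UnitAddTorus (Fin d)) (f : C(UnitAddTorus (Fin d), ℂ)) (x) :
    translate v f x = f (x + v) := rfl

lemma lpNorm_translate (m : ℕ) (v : UnitAddTorus (Fin d)) (f : C(UnitAddTorus (Fin d), ℂ)) :
    lpNorm m (translate v f) = lpNorm m f := by
  rw [← pow_left_inj₀ (lpNorm_nonneg _ _) (lpNorm_nonneg _ _) (by omega : 2 * (m + 1) ≠ 0),
    lpNorm_pow, lpNorm_pow]
  exact integral_add_right_eq_self (fun x => ‖f x‖ ^ (2 * (m + 1))) v

/-- The function `|f|`. -/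
noncomputable def absMap (f : C(UnitAddTorus (Fin d), ℂ)) : C(UnitAddTorus (Fin d), ℂ) :=
  ⟨fun x => (‖f x‖ : ℂ), by fun_prop⟩

lemma lpNorm_absMap (m : ℕ) (f : C(UnitAddTorus (Fin d), ℂ)) : lpNorm m (absMap f) = lpNorm m f :=
  le_antisymm (lpNorm_mono fun x => by simp [absMap]) (lpNorm_mono fun x => by simp [absMap])

/-- Duality estimate against a difference `τ_v H - H`. -/
lemma integral_pow_mul_translate_sub_le (m : ℕ) (v : UnitAddTorus (Fin d))
    (g H : C(UnitAddTorus (Fin d), ℂ)) :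
    ∫ x, ‖g x‖ ^ (2 * m) * ((starRingEnd ℂ) (g x) * (translate v H x - H x)).re ∂(torusMeasure d) ≤
      2 * (2 * m + 1) * (lpNorm m g ^ (2 * m) * lpNorm m (translate v g - g) * lpNorm m H) := by
  have hcv : Continuous fun x => g (x - v) := by fun_prop
  have e1 : ∀ x, ‖g x‖ ^ (2 * m) * ((starRingEnd ℂ) (g x) * (translate v H x - H x)).re =
      ‖g x‖ ^ (2 * m) * ((starRingEnd ℂ) (g x) * H (x + v)).re -
      ‖g x‖ ^ (2 * m) * ((starRingEnd ℂ) (g x) * H x).re := fun x => by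
    rw [translate_apply, mul_sub, Complex.sub_re, mul_sub]
  -- Translation invariance moves the shift from `H` onto `|g|^{p-2} ḡ`.
  have e2 : ∫ x, ‖g x‖ ^ (2 * m) * ((starRingEnd ℂ) (g x) * H (x + v)).re ∂(torusMeasure d) =
      ∫ x, ‖g (x - v)‖ ^ (2 * m) * ((starRingEnd ℂ) (g (x - v)) * H x).re ∂(torusMeasure d) := by
    rw [← integral_add_right_eq_self
      (fun x => ‖g (x - v)‖ ^ (2 * m) * ((starRingEnd ℂ) (g (x - v)) * H x).re) v]
    simp only [add_sub_cancel_right]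
  have hc0 : Continuous fun x => ‖g x‖ ^ (2 * m) * ((starRingEnd ℂ) (g x) * H (x + v)).re := by
    fun_prop
  have hc1 : Continuous fun x => ‖g x‖ ^ (2 * m) * ((starRingEnd ℂ) (g x) * H x).re := by fun_prop
  have hc2 : Continuous fun x => ‖g (x - v)‖ ^ (2 * m) * ((starRingEnd ℂ) (g (x - v)) * H x).re := by
    fun_prop
  set δ : C(UnitAddTorus (Fin d), ℂ) := translate (-v) g - g with hδ
  have hδx : ∀ x, δ x = g (x - v) - g x := fun x => by
    rw [hδ, ContinuousMap.sub_apply, translate_apply, sub_eq_add_neg x v]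
  -- The Lipschitz bound for `z ↦ |z|^{2m} z` gives two terms. Hölder bounds both by the same
  -- quantity, since `g` and its translate have equal norms; hence the constant `2(2m+1)`.
  have hpt : ∀ x, ‖g (x - v)‖ ^ (2 * m) * ((starRingEnd ℂ) (g (x - v)) * H x).re -
      ‖g x‖ ^ (2 * m) * ((starRingEnd ℂ) (g x) * H x).re ≤
      (2 * m + 1) * (‖translate (-v) g x‖ ^ (2 * m) * ‖δ x‖ * ‖H x‖) +
      (2 * m + 1) * (‖g x‖ ^ (2 * m) * ‖δ x‖ * ‖H x‖) := by
    intro x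
    have h1 : ‖g (x - v)‖ ^ (2 * m) * ((starRingEnd ℂ) (g (x - v)) * H x).re -
      ‖g x‖ ^ (2 * m) * ((starRingEnd ℂ) (g x) * H x).re =
      ((starRingEnd ℂ) (((‖g (x - v)‖ ^ (2 * m) : ℝ) : ℂ) * g (x - v) -
        ((‖g x‖ ^ (2 * m) : ℝ) : ℂ) * g x) * H x).re := by
      rw [map_sub (starRingEnd ℂ), map_mul, map_mul, Complex.conj_ofReal, Complex.conj_ofReal, sub_mul, mul_assoc,
        mul_assoc, Complex.sub_re, Complex.re_ofReal_mul, Complex.re_ofReal_mul]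
    rw [h1, translate_apply, ← sub_eq_add_neg, hδx]
    refine (Complex.re_le_norm _).trans ?_
    rw [norm_mul, RCLike.norm_conj]
    refine (mul_le_mul_of_nonneg_right (norm_pow_mul_sub_le _ _ _) (norm_nonneg _)).trans ?_
    push_cast
    apply le_of_eq; ring
  have hδn : lpNorm m δ = lpNorm m (translate v g - g) := by
    rw [← lpNorm_translate m v δ]
    have : translate v δ = -(translate v g - g) := by
      ext x
      simp only [translate_apply, hδx, ContinuousMap.neg_apply, ContinuousMap.sub_apply,
        add_sub_cancel_right]
      ring
    rw [this, lpNorm, lpNorm, map_neg, norm_neg]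
  simp_rw [e1]
  rw [integral_sub (integrable_continuousMap hc0) (integrable_continuousMap hc1), e2,
    ← integral_sub (integrable_continuousMap hc2) (integrable_continuousMap hc1)]
  have hc3 : Continuous fun x => ‖translate (-v) g x‖ ^ (2 * m) * ‖δ x‖ * ‖H x‖ := by fun_prop
  have hc4 : Continuous fun x => ‖g x‖ ^ (2 * m) * ‖δ x‖ * ‖H x‖ := by fun_prop
  have I3 := (integrable_continuousMap hc3).const_mul (2 * (m : ℝ) + 1)
  have I4 := (integrable_continuousMap hc4).const_mul (2 * (m : ℝ) + 1)
  refine (integral_mono (integrable_continuousMap (hc2.sub hc1)) (I3.add I4) hpt).trans ?_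
  rw [integral_add' I3 I4, integral_const_mul, integral_const_mul]
  have i1 := integral_pow_mul_mul_le m (translate (-v) g) δ H
  have i2 := integral_pow_mul_mul_le m g δ H
  rw [lpNorm_translate] at i1
  rw [← hδn]
  have hm : (0 : ℝ) ≤ 2 * m + 1 := by positivity
  nlinarith [mul_le_mul_of_nonneg_left i1 hm, mul_le_mul_of_nonneg_left i2 hm]

/-- Two-smoothness of `L^p` with the linear term controlled by `Λ`. -/
lemma lpNorm_add_sq_le (m : ℕ) (g h : C(UnitAddTorus (Fin d), ℂ)) {Λ : ℝ} (hΛ : 0 ≤ Λ)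
    (hlin : ∫ x, ‖g x‖ ^ (2 * m) * ((starRingEnd ℂ) (g x) * h x).re ∂(torusMeasure d) ≤
      Λ * lpNorm m g ^ (2 * m)) :
    lpNorm m (g + h) ^ 2 ≤ lpNorm m g ^ 2 + 2 * Λ + 6 * (m + 1) * lpNorm m h ^ 2 := by
  refine sq_le_of_pow_le (lpNorm_nonneg _ _) (lpNorm_nonneg _ _) (lpNorm_nonneg _ _) hΛ
    (lpNorm_add_le m g h) m ?_
  -- Realises `|g| + |h|` as one function, so that Hölder applies to the remainder with the triangle
  -- inequality for its norm.
  set u := absMap g + absMap h with hu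
  have hun : lpNorm m u ≤ lpNorm m g + lpNorm m h := by
    refine (lpNorm_add_le m _ _).trans ?_
    rw [lpNorm_absMap, lpNorm_absMap]
  have hux : ∀ x, ‖u x‖ = ‖g x‖ + ‖h x‖ := fun x => by
    simp only [hu, absMap, ContinuousMap.add_apply, ContinuousMap.coe_mk]
    rw [← Complex.ofReal_add, Complex.norm_real, Real.norm_of_nonneg (by positivity)]
  have hc1 : Continuous fun x => ‖g x‖ ^ (2 * (m + 1)) := by fun_prop
  have hc2 : Continuous fun x => ‖g x‖ ^ (2 * m) * ((starRingEnd ℂ) (g x) * h x).re := by fun_prop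
  have hc3 : Continuous fun x => ‖u x‖ ^ (2 * m) * ‖h x‖ * ‖h x‖ := by fun_prop
  have I1 := integrable_continuousMap hc1
  have I2 := (integrable_continuousMap hc2).const_mul (2 * ((m : ℝ) + 1))
  have I3 := (integrable_continuousMap hc3).const_mul (2 * ((m : ℝ) + 1) ^ 2)
  have hint := integral_mono
    (integrable_continuousMap (by fun_prop : Continuous fun x => ‖(g + h) x‖ ^ (2 * (m + 1))))
    ((I1.add I2).add I3) (fun x => by
      have := norm_add_pow_le (g x) (h x) m
      rw [← hux] at this
      exact this)
  rw [integral_add' (I1.add I2) I3, integral_add' I1 I2, integral_const_mul, integral_const_mul,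
    ← lpNorm_pow, ← lpNorm_pow] at hint
  have h3 := integral_pow_mul_mul_le m u h h
  have h4 : lpNorm m u ^ (2 * m) * lpNorm m h * lpNorm m h ≤
      (lpNorm m g + lpNorm m h) ^ (2 * m) * lpNorm m h ^ 2 := by
    rw [mul_assoc, ← sq]
    have := lpNorm_nonneg m u
    gcongr
  have h5 := h3.trans h4
  refine hint.trans ?_
  gcongr

/-! ### Trigonometric polynomials, Bernstein's inequality and inverse differences -/

/-- The block index is the binary length of `|n|`, including length `0` for `n = 0`; blocks then
become fibres of a single function. -/
lemma mem_dyadicBlock {n : ℤ} {k : ℕ} : n ∈ dyadicBlock k ↔ n.natAbs.size = k := by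
  rcases k with _ | k
  · rw [Nat.size_eq_zero, Int.natAbs_eq_zero]; simp [dyadicBlock]
  · have h1 : n.natAbs.size = k + 1 ↔ 2 ^ k ≤ n.natAbs ∧ n.natAbs < 2 ^ (k + 1) := by
      rw [← Nat.size_le, ← Nat.lt_size]; omega
    rw [h1, dyadicBlock, Finset.mem_union, Finset.mem_Icc, Finset.mem_Icc]
    zify
    have h2 : (0 : ℤ) < 2 ^ k := by positivity
    have h3 : (2 : ℤ) ^ (k + 1) = 2 * 2 ^ k := by ring
    rw [h3]
    generalize (2 : ℤ) ^ k = M at *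
    rcases abs_cases n with ⟨h, h'⟩ | ⟨h, h'⟩ <;> rw [h] <;> omega

lemma abs_lt_two_pow_size (n : ℤ) : |(n : ℝ)| < 2 ^ n.natAbs.size := by
  have := Nat.lt_size_self n.natAbs
  rw [← Int.cast_abs, Int.abs_eq_natAbs]
  exact_mod_cast this

lemma two_pow_le_abs {n : ℤ} {k : ℕ} (h : n.natAbs.size = k + 1) : 2 ^ k ≤ |(n : ℝ)| := by
  have := Nat.lt_size.1 (by omega : k < n.natAbs.size)
  rw [← Int.cast_abs, Int.abs_eq_natAbs]
  exact_mod_cast this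

/-- The trigonometric polynomial with frequencies in `F` and coefficients `a`. -/
noncomputable def trigPoly (F : Finset (Fin d → ℤ)) (a : (Fin d → ℤ) → ℂ) :
    C(UnitAddTorus (Fin d), ℂ) := ∑ n ∈ F, a n • UnitAddTorus.mFourier n

/-- Translation by `t` in the direction of the `j`-th coordinate. -/
noncomputable def shift (j : Fin d) (t : ℝ) (f : C(UnitAddTorus (Fin d), ℂ)) :
    C(UnitAddTorus (Fin d), ℂ) := translate (Pi.single j (t : UnitAddCircle)) f

lemma lpNorm_shift (m : ℕ) (j : Fin d) (t : ℝ) (f : C(UnitAddTorus (Fin d), ℂ)) :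
    lpNorm m (shift j t f) = lpNorm m f := lpNorm_translate m _ f

lemma mFourier_add_single (n : Fin d → ℤ) (j : Fin d) (t : ℝ) (x : UnitAddTorus (Fin d)) :
    UnitAddTorus.mFourier n (x + Pi.single j (t : UnitAddCircle)) =
      expi (n j * t) * UnitAddTorus.mFourier n x := by
  have hchar : ∀ x y : UnitAddTorus (Fin d), UnitAddTorus.mFourier n (x + y) =
      UnitAddTorus.mFourier n y * UnitAddTorus.mFourier n x := by
    intro x y
    simp only [UnitAddTorus.mFourier, ContinuousMap.coe_mk, ← Finset.prod_mul_distrib]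
    refine Finset.prod_congr rfl fun i _ => ?_
    rw [Pi.add_apply, fourier_apply, fourier_apply, fourier_apply, smul_add, AddCircle.toCircle_add,
      Circle.coe_mul, mul_comm]
  rw [hchar]
  congr 1
  rw [← fourier_coe_eq_expi]
  simp only [UnitAddTorus.mFourier, ContinuousMap.coe_mk]
  rw [Finset.prod_eq_single j]
  · rw [Pi.single_eq_same]
  · intro i _ hi
    rw [Pi.single_eq_of_ne hi, fourier_eval_zero]
  · simp

lemma trigPoly_apply (F : Finset (Fin d → ℤ)) (a : (Fin d → ℤ) → ℂ) (x) :
    trigPoly F a x = ∑ n ∈ F, a n * UnitAddTorus.mFourier n x := by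
  simp [trigPoly, ContinuousMap.sum_apply]

lemma shift_trigPoly (F : Finset (Fin d → ℤ)) (a : (Fin d → ℤ) → ℂ) (j : Fin d) (t : ℝ) :
    shift j t (trigPoly F a) = trigPoly F fun n => expi (n j * t) * a n := by
  ext x
  rw [shift, translate_apply, trigPoly_apply, trigPoly_apply]
  refine Finset.sum_congr rfl fun n _ => ?_
  rw [mFourier_add_single]; ring

/-- Multipliers given by absolutely convergent trigonometric series are bounded. -/
lemma lpNorm_multiplier_le (m : ℕ) {c : ℤ → ℂ} (hc : Summable fun l => ‖c l‖)
    (F : Finset (Fin d → ℤ)) (a w : (Fin d → ℤ) → ℂ) (j : Fin d) (δ : ℝ)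
    (hw : ∀ n ∈ F, HasSum (fun l : ℤ => c l * expi (l * (n j * δ))) (w n)) :
    lpNorm m (trigPoly F fun n => w n * a n) ≤ (∑' l, ‖c l‖) * lpNorm m (trigPoly F a) := by
  set T := ContinuousMap.toLp (E := ℂ) (evenExp m) (torusMeasure d) ℂ with hT
  -- The multiplier is an `ℓ¹` combination of translations by `lδ` in coordinate `j`, each an
  -- isometry of `L^p`; this makes the constant independent of `p`.
  have hs : HasSum (fun l : ℤ => c l • T (shift j (l * δ) (trigPoly F a)))
      (T (trigPoly F fun n => w n * a n)) := by
    have h1 : ∀ l : ℤ, c l • T (shift j (l * δ) (trigPoly F a)) =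
        ∑ n ∈ F, (c l * expi (l * (n j * δ))) • (a n • T (UnitAddTorus.mFourier n)) := by
      intro l
      rw [shift_trigPoly, trigPoly, map_sum, Finset.smul_sum]
      refine Finset.sum_congr rfl fun n _ => ?_
      rw [map_smul, smul_smul, smul_smul, show (l : ℝ) * (n j * δ) = n j * (l * δ) by ring, mul_assoc]
    have h2 : T (trigPoly F fun n => w n * a n) =
        ∑ n ∈ F, w n • (a n • T (UnitAddTorus.mFourier n)) := by
      rw [trigPoly, map_sum]
      refine Finset.sum_congr rfl fun n _ => ?_
      rw [map_smul, smul_smul]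
    simp_rw [h1]
    rw [h2]
    exact hasSum_sum fun n hn => (hw n hn).smul_const _
  have hn : ∀ l : ℤ, ‖c l • T (shift j (l * δ) (trigPoly F a))‖ = ‖c l‖ * lpNorm m (trigPoly F a) :=
    fun l => by rw [norm_smul, ← lpNorm_shift m j (l * δ)]; rfl
  rw [lpNorm, ← hT, ← tsum_mul_right]
  refine hs.norm_le_of_bounded (Summable.hasSum ?_) (fun l => (hn l).le)
  exact hc.mul_right _

/-- The derivative of a trigonometric polynomial in the `j`-th coordinate. -/
noncomputable def trigDeriv (j : Fin d) (F : Finset (Fin d → ℤ)) (a : (Fin d → ℤ) → ℂ) :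
    C(UnitAddTorus (Fin d), ℂ) :=
  trigPoly F fun n => (2 * Real.pi * Complex.I * n j) * a n

lemma hasDerivAt_expi_mul (r s : ℝ) :
    HasDerivAt (fun s : ℝ => expi (r * s)) (2 * Real.pi * Complex.I * r * expi (r * s)) s := by
  have h : HasDerivAt (fun s : ℝ => 2 * Real.pi * Complex.I * ((r * s : ℝ) : ℂ))
      (2 * Real.pi * Complex.I * r) s := by
    have h0 := ((hasDerivAt_id s).const_mul r).ofReal_comp.const_mul (2 * Real.pi * Complex.I)
    simpa using h0
  have := h.cexp
  unfold expi
  convert this using 1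
  ring

/-- Mean value inequality along the `L^p`-valued curve `s ↦ τ_s f`, whose derivative is `τ_s` of the
derivative and so has constant norm. -/
lemma lpNorm_shift_sub_le (m : ℕ) (j : Fin d) (t : ℝ) (F : Finset (Fin d → ℤ))
    (a : (Fin d → ℤ) → ℂ) :
    lpNorm m (shift j t (trigPoly F a) - trigPoly F a) ≤ |t| * lpNorm m (trigDeriv j F a) := by
  set T := ContinuousMap.toLp (E := ℂ) (evenExp m) (torusMeasure d) ℂ with hT
  have hd : ∀ s : ℝ, HasDerivAt (fun s : ℝ => T (shift j s (trigPoly F a)))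
      (T (shift j s (trigDeriv j F a))) s := by
    intro s
    have h1 : (fun s : ℝ => T (shift j s (trigPoly F a))) =
        fun s : ℝ => ∑ n ∈ F, expi (n j * s) • (a n • T (UnitAddTorus.mFourier n)) := by
      funext s
      rw [shift_trigPoly, trigPoly, map_sum]
      exact Finset.sum_congr rfl fun n _ => by rw [map_smul, smul_smul]
    have h2 : T (shift j s (trigDeriv j F a)) =
        ∑ n ∈ F, (2 * Real.pi * Complex.I * ((n j : ℝ) : ℂ) * expi (n j * s)) •
          (a n • T (UnitAddTorus.mFourier n)) := by
      rw [trigDeriv, shift_trigPoly, trigPoly, map_sum]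
      refine Finset.sum_congr rfl fun n _ => ?_
      rw [map_smul, smul_smul]
      congr 1; push_cast; ring
    rw [h1, h2]
    exact HasDerivAt.fun_sum fun n _ => (hasDerivAt_expi_mul (n j) s).smul_const _
  have hmv := Convex.norm_image_sub_le_of_norm_hasDerivWithin_le (𝕜 := ℝ) (s := Set.univ)
    (f := fun s : ℝ => T (shift j s (trigPoly F a))) (C := lpNorm m (trigDeriv j F a))
    (fun s _ => (hd s).hasDerivWithinAt)
    (fun s _ => by rw [← lpNorm_shift m j s (trigDeriv j F a)]; rfl) convex_univ
    (Set.mem_univ 0) (Set.mem_univ t)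
  have h0 : shift j 0 (trigPoly F a) = trigPoly F a := by
    rw [shift_trigPoly]; congr 1; funext n; rw [mul_zero, expi_zero, one_mul]
  rw [h0, sub_zero, ← map_sub, Real.norm_eq_abs, mul_comm] at hmv
  exact hmv

/-- Bernstein's inequality in one coordinate direction, uniformly in the exponent. -/
lemma exists_bernstein (d : ℕ) : ∃ C : ℝ, 0 < C ∧ ∀ (m : ℕ) (j : Fin d) (k : ℕ) (F : Finset (Fin d → ℤ))
    (a : (Fin d → ℤ) → ℂ), (∀ n ∈ F, (n j).natAbs.size = k) →
      lpNorm m (trigDeriv j F a) ≤ C * 2 ^ k * lpNorm m (trigPoly F a) := by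
  obtain ⟨c, hc, hsum⟩ := exists_summable_expi_expansion (ψ := fun x : ℝ => (x : ℂ))
    Complex.ofRealCLM.contDiff
  set A := ∑' l, ‖c l‖
  have hA : 0 ≤ A := tsum_nonneg fun l => norm_nonneg _
  refine ⟨8 * Real.pi * (A + 1), by positivity, fun m j k F a hF => ?_⟩
  -- Since `|n_j| < 2^k`, this scale puts `n_j δ` in `[-1/4, 1/4]`, where the symbol `x` has its
  -- expansion.
  have hδ : (0 : ℝ) < 1 / (4 * 2 ^ k) := by positivity
  have h1 := lpNorm_multiplier_le m hc F a (fun n => ((n j * (1 / (4 * 2 ^ k)) : ℝ) : ℂ)) j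
    (1 / (4 * 2 ^ k)) (fun n hn => by
      refine hsum _ ?_
      have := abs_lt_two_pow_size (n j)
      rw [hF n hn] at this
      rw [abs_mul, abs_of_pos hδ, mul_one_div, div_le_div_iff₀ (by positivity) (by norm_num)]
      linarith)
  have h2 : trigDeriv j F a = (2 * Real.pi * Complex.I * (4 * 2 ^ k)) •
      trigPoly F (fun n => ((n j * (1 / (4 * 2 ^ k)) : ℝ) : ℂ) * a n) := by
    rw [trigDeriv, trigPoly, trigPoly, Finset.smul_sum]
    refine Finset.sum_congr rfl fun n _ => ?_
    rw [smul_smul]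
    congr 1
    push_cast
    field_simp
  have h3 : lpNorm m (trigDeriv j F a) = (2 * Real.pi * (4 * 2 ^ k)) *
      lpNorm m (trigPoly F (fun n => ((n j * (1 / (4 * 2 ^ k)) : ℝ) : ℂ) * a n)) := by
    rw [h2, lpNorm, map_smul, norm_smul, ← lpNorm]
    congr 1
    simp [abs_of_pos Real.pi_pos]
  rw [h3]
  have hP := lpNorm_nonneg m (trigPoly F a)
  calc _ ≤ (2 * Real.pi * (4 * 2 ^ k)) * ((A + 1) * lpNorm m (trigPoly F a)) := by
        gcongr
        exact h1.trans (by gcongr; linarith)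
    _ = _ := by ring

/-- A function with frequencies `|n_j| ∈ [2 ^ k, 2 ^ (k + 1))` is a difference of translates at
scale `2 ^ (-k)` of a function of comparable norm. -/
lemma exists_eq_shift_sub (d : ℕ) : ∃ C : ℝ, 0 < C ∧ ∀ (m : ℕ) (j : Fin d) (k : ℕ)
    (F : Finset (Fin d → ℤ)) (a : (Fin d → ℤ) → ℂ), (∀ n ∈ F, (n j).natAbs.size = k + 1) →
      ∃ H, trigPoly F a = shift j (1 / (8 * 2 ^ k)) H - H ∧
        lpNorm m H ≤ C * lpNorm m (trigPoly F a) := by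
  obtain ⟨ψ, hψ, hinv⟩ := exists_smooth_inverse_expi_sub_one
  obtain ⟨c, hc, hsum⟩ := exists_summable_expi_expansion hψ
  set A := ∑' l, ‖c l‖
  have hA : 0 ≤ A := tsum_nonneg fun l => norm_nonneg _
  refine ⟨A + 1, by positivity, fun m j k F a hF => ?_⟩
  -- For `2^k ≤ |n_j| < 2^(k+1)` this places `|n_j δ|` between `1/8` and `1/4`, where `ψ` inverts
  -- `expi - 1`.
  have hδ : (0 : ℝ) < 1 / (8 * 2 ^ k) := by positivity
  have hup : ∀ n ∈ F, |n j * (1 / (8 * 2 ^ k) : ℝ)| ≤ 1 / 4 := by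
    intro n hn
    have := abs_lt_two_pow_size (n j)
    rw [hF n hn, pow_succ] at this
    rw [abs_mul, abs_of_pos hδ, mul_one_div, div_le_div_iff₀ (by positivity) (by norm_num)]
    linarith
  have hlo : ∀ n ∈ F, 1 / 8 ≤ |n j * (1 / (8 * 2 ^ k) : ℝ)| := by
    intro n hn
    have := two_pow_le_abs (hF n hn)
    rw [abs_mul, abs_of_pos hδ, mul_one_div, div_le_div_iff₀ (by norm_num) (by positivity)]
    linarith
  refine ⟨trigPoly F fun n => ψ (n j * (1 / (8 * 2 ^ k))) * a n, ?_, ?_⟩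
  · ext x
    rw [shift_trigPoly, ContinuousMap.sub_apply, trigPoly_apply, trigPoly_apply, trigPoly_apply,
      ← Finset.sum_sub_distrib]
    refine Finset.sum_congr rfl fun n hn => ?_
    linear_combination (-a n * UnitAddTorus.mFourier n x) * hinv _ (hlo n hn) (hup n hn)
  · refine (lpNorm_multiplier_le m hc F a (fun n => ψ (n j * (1 / (8 * 2 ^ k)))) j
      (1 / (8 * 2 ^ k)) (fun n hn => hsum _ (hup n hn))).trans ?_
    have hP := lpNorm_nonneg m (trigPoly F a)
    gcongr
    linarith

/-! ### Square function estimates -/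

lemma shift_sum {ι : Type*} (j : Fin d) (t : ℝ) (s : Finset ι) (f : ι → C(UnitAddTorus (Fin d), ℂ)) :
    shift j t (∑ i ∈ s, f i) = ∑ i ∈ s, shift j t (f i) := by
  ext x
  simp [shift, translate_apply, ContinuousMap.sum_apply]

/-- The part of a finite set of frequencies lying in the `k`-th dyadic block of coordinate `j`. -/
def coordBlock (F : Finset (Fin d → ℤ)) (j : Fin d) (k : ℕ) : Finset (Fin d → ℤ) :=
  F.filter fun n => (n j).natAbs.size = k

lemma size_of_mem_coordBlock {F : Finset (Fin d → ℤ)} {j : Fin d} {k : ℕ} {n : Fin d → ℤ}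
    (hn : n ∈ coordBlock F j k) : (n j).natAbs.size = k := (Finset.mem_filter.1 hn).2

lemma trigPoly_eq_sum_coordBlock (F : Finset (Fin d → ℤ)) (a : (Fin d → ℤ) → ℂ) (j : Fin d) {N : ℕ}
    (hF : ∀ n ∈ F, (n j).natAbs.size < N) :
    trigPoly F a = ∑ k ∈ Finset.range N, trigPoly (coordBlock F j k) a := by
  unfold trigPoly coordBlock
  exact (Finset.sum_fiberwise_of_maps_to (fun n hn => Finset.mem_range.2 (hF n hn)) _).symm

/-- One-parameter square function estimate in `L^p` with constant `O(√p)`. -/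
lemma exists_lpNorm_sq_le_sum_coordBlock (d : ℕ) : ∃ C : ℝ, 0 < C ∧ ∀ (m : ℕ) (j : Fin d) (N : ℕ)
    (F : Finset (Fin d → ℤ)) (a : (Fin d → ℤ) → ℂ), (∀ n ∈ F, (n j).natAbs.size < N) →
      lpNorm m (trigPoly F a) ^ 2 ≤
        C * (m + 1) * ∑ k ∈ Finset.range N, lpNorm m (trigPoly (coordBlock F j k) a) ^ 2 := by
  obtain ⟨CB, hCB, hB⟩ := exists_bernstein d
  obtain ⟨CI, hCI, hI⟩ := exists_eq_shift_sub d
  refine ⟨2 * (CB * CI) + 6, by positivity, fun m j N F a hF => ?_⟩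
  set f : ℕ → C(UnitAddTorus (Fin d), ℂ) := fun k => trigPoly (coordBlock F j k) a with hf
  set b : ℕ → ℝ := fun k => lpNorm m (f k) with hb
  have hb0 : ∀ k, 0 ≤ b k := fun k => lpNorm_nonneg _ _
  have hreal : ∀ {G D A h B : ℝ}, 0 ≤ G → 0 ≤ A → 0 ≤ B → 0 ≤ h → D ≤ CB / 4 * A → h ≤ CI * B →
      2 * (2 * m + 1) * (G * D * h) ≤ (m + 1) * (CB * CI) * (B * A) * G := by
    intro G D A h B hG hA hB hh hD hhB
    have hX : 0 ≤ (CB * CI) * (B * A) * G := by positivity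
    calc 2 * (2 * m + 1) * (G * D * h) ≤ 2 * (2 * m + 1) * (G * (CB / 4 * A) * (CI * B)) := by gcongr
      _ = (m + 1 / 2) * ((CB * CI) * (B * A) * G) := by ring
      _ ≤ (m + 1) * ((CB * CI) * (B * A) * G) := by gcongr; norm_num
      _ = _ := by ring
  have hstep : ∀ K, lpNorm m (∑ k ∈ Finset.range (K + 1), f k) ^ 2 ≤
      lpNorm m (∑ k ∈ Finset.range K, f k) ^ 2 +
      2 * ((m + 1) * (CB * CI) * (b K * ∑ k ∈ Finset.range K, (1 / 2 : ℝ) ^ (K - k) * b k)) +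
      6 * (m + 1) * b K ^ 2 := by
    intro K
    rw [Finset.sum_range_succ]
    have hA0 : 0 ≤ ∑ k ∈ Finset.range K, (1 / 2 : ℝ) ^ (K - k) * b k :=
      Finset.sum_nonneg fun k _ => mul_nonneg (by positivity) (hb0 k)
    refine lpNorm_add_sq_le m _ _ (mul_nonneg (by positivity) (mul_nonneg (hb0 K) hA0)) ?_
    -- The zero-frequency block is not a difference of translates, but nothing lies below it, so its
    -- linear term vanishes.
    rcases K with _ | K
    · simp
    obtain ⟨H, hH, hHn⟩ := hI m j K (coordBlock F j (K + 1)) a fun n hn => size_of_mem_coordBlock hn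
    set g := ∑ k ∈ Finset.range (K + 1), f k with hg
    -- Bernstein blockwise: `2^k / (8 · 2^K) = 2^(k-(K+1)) / 4`, the kernel of Schur's test.
    have hdiff : lpNorm m (shift j (1 / (8 * 2 ^ K)) g - g) ≤
        CB / 4 * ∑ k ∈ Finset.range (K + 1), (1 / 2 : ℝ) ^ (K + 1 - k) * b k := by
      rw [hg, shift_sum, ← Finset.sum_sub_distrib, Finset.mul_sum]
      refine (lpNorm_sum_le m _ _).trans (Finset.sum_le_sum fun k hk => ?_)
      refine (lpNorm_shift_sub_le m j _ _ _).trans ?_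
      rw [abs_of_pos (by positivity)]
      have h1 := hB m j k (coordBlock F j k) a fun n hn => size_of_mem_coordBlock hn
      calc _ ≤ 1 / (8 * 2 ^ K) * (CB * 2 ^ k * b k) := by gcongr
        _ = CB / 4 * ((1 / 2 : ℝ) ^ (K + 1 - k) * b k) := by
          have hk' : k ≤ K + 1 := (Finset.mem_range.1 hk).le
          have h2 : (2 : ℝ) ^ (K + 1 - k) * 2 ^ k = 2 * 2 ^ K := by
            rw [← pow_add, Nat.sub_add_cancel hk', pow_succ]; ring
          rw [one_div_pow]
          have h3 : (2 : ℝ) ^ (K + 1 - k) ≠ 0 := by positivity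
          field_simp
          linear_combination (4 * b k) * h2
    have hlin := integral_pow_mul_translate_sub_le m (Pi.single j ((1 / (8 * 2 ^ K) : ℝ) : UnitAddCircle)) g H
    have hfK : ∀ x, f (K + 1) x =
        translate (Pi.single j ((1 / (8 * 2 ^ K) : ℝ) : UnitAddCircle)) H x - H x := fun x => by
      simp only [hf]; rw [hH]; rfl
    simp_rw [hfK]
    refine hlin.trans ?_
    exact hreal (pow_nonneg (lpNorm_nonneg m g) _) hA0 (hb0 (K + 1)) (lpNorm_nonneg _ _) hdiff hHn
  have hind : ∀ K, lpNorm m (∑ k ∈ Finset.range K, f k) ^ 2 ≤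
      2 * ((m + 1) * (CB * CI)) *
        ∑ L ∈ Finset.range K, b L * ∑ k ∈ Finset.range L, (1 / 2 : ℝ) ^ (L - k) * b k +
      6 * (m + 1) * ∑ L ∈ Finset.range K, b L ^ 2 := by
    intro K
    induction K with
    | zero => simp [lpNorm_zero]
    | succ K ih =>
      refine (hstep K).trans ?_
      rw [Finset.sum_range_succ (fun L => b L * _), Finset.sum_range_succ (fun L => b L ^ 2)]
      linarith
  rw [trigPoly_eq_sum_coordBlock F a j hF]
  refine (hind N).trans ?_
  have hS := mul_le_mul_of_nonneg_left (sum_mul_geometric_le b N)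
    (by positivity : 0 ≤ 2 * (((m : ℝ) + 1) * (CB * CI)))
  calc _ ≤ _ := add_le_add_left hS _
    _ = _ := by ring

/-- Exchanging the `j`-th entry with the extra index is an involution on pairs; the factor `N`
counts the entry that is then forgotten. -/
lemma sum_sum_update {N : ℕ} (j : Fin d) (P : (Fin d → Fin N) → ℝ) :
    ∑ k : Fin d → Fin N, ∑ l : Fin N, P (Function.update k j l) = N * ∑ k, P k := by
  let σ : (Fin d → Fin N) × Fin N ≃ (Fin d → Fin N) × Fin N :=
    { toFun := fun p => (Function.update p.1 j p.2, p.1 j)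
      invFun := fun p => (Function.update p.1 j p.2, p.1 j)
      left_inv := fun p => by simp
      right_inv := fun p => by simp }
  calc _ = ∑ p : (Fin d → Fin N) × Fin N, P (σ p).1 := (Fintype.sum_prod_type' _).symm
    _ = ∑ p : (Fin d → Fin N) × Fin N, P p.1 := Equiv.sum_comp σ fun p => P p.1
    _ = _ := by simp [Fintype.sum_prod_type, Finset.mul_sum]

/-- Multi-parameter square function estimate in `L^p` with constant `O(p^{d/2})`. -/
lemma exists_lpNorm_sq_le_sum (d : ℕ) : ∃ C : ℝ, 0 < C ∧ ∀ (m : ℕ) (N : ℕ)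
    (F : Finset (Fin d → ℤ)) (a : (Fin d → ℤ) → ℂ), (∀ n ∈ F, ∀ j, (n j).natAbs.size < N) →
      lpNorm m (trigPoly F a) ^ 2 ≤
        (C * (m + 1)) ^ d * ∑ k : Fin d → Fin N,
          lpNorm m (trigPoly (F.filter fun n => ∀ i, (n i).natAbs.size = k i) a) ^ 2 := by
  obtain ⟨C, hC, h⟩ := exists_lpNorm_sq_le_sum_coordBlock d
  refine ⟨C, hC, fun m N F a hF => ?_⟩
  -- A power of `N` is cancelled at the end, so `N = 0` is separate.
  rcases Nat.eq_zero_or_pos N with rfl | hN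
  · rcases d with _ | d
    · simp
    · have : F = ∅ := Finset.eq_empty_of_forall_notMem fun n hn => by simpa using hF n hn 0
      subst this
      simp [trigPoly, lpNorm_zero]
  -- `Q J k` localises only the coordinates in `J` but is always summed over every `k`. The
  -- resulting overcounting is tracked by powers of `N`, which cancel once `J` is everything.
  set Q : Finset (Fin d) → (Fin d → Fin N) → ℝ := fun J k =>
    lpNorm m (trigPoly (F.filter fun n => ∀ i ∈ J, (n i).natAbs.size = k i) a) ^ 2 with hQ
  have hind : ∀ J : Finset (Fin d), ∑ k, Q ∅ k ≤ (C * (m + 1) * N) ^ J.card * ∑ k, Q J k := by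
    intro J
    induction J using Finset.induction_on with
    | empty => simp
    | insert j J hj ih =>
      refine ih.trans ?_
      rw [Finset.card_insert_of_notMem hj, pow_succ, mul_assoc (_ ^ J.card)]
      refine mul_le_mul_of_nonneg_left ?_ (by positivity : (0 : ℝ) ≤ (C * (m + 1) * N) ^ J.card)
      rw [mul_assoc, ← sum_sum_update j, Finset.mul_sum]
      refine Finset.sum_le_sum fun k _ => ?_
      refine (h m j N _ a fun n hn => hF n (Finset.mem_filter.1 hn).1 j).trans ?_
      rw [← Fin.sum_univ_eq_sum_range (fun l => lpNorm m (trigPoly (coordBlock _ j l) a) ^ 2)]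
      refine le_of_eq ?_
      congr 1
      refine Finset.sum_congr rfl fun l _ => ?_
      simp only [hQ]
      congr 3
      rw [coordBlock, Finset.filter_filter]
      refine Finset.filter_congr fun n _ => ?_
      rw [Finset.forall_mem_insert, Function.update_self, and_comm]
      refine and_congr_right fun _ => forall₂_congr fun i hi => ?_
      rw [Function.update_of_ne (ne_of_mem_of_not_mem hi hj)]
  have h1 := hind Finset.univ
  have h2 : ∑ k, Q ∅ k = (N : ℝ) ^ d * lpNorm m (trigPoly F a) ^ 2 := by
    simp [hQ]
  rw [h2, Finset.card_univ, Fintype.card_fin, mul_pow, mul_comm _ ((N : ℝ) ^ d), mul_assoc] at h1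
  have h3 := le_of_mul_le_mul_left h1 (by positivity)
  simpa only [hQ, Finset.mem_univ, true_imp_iff] using h3

/-! ### Fourier uniqueness and convergence of box partial sums -/

open Filter Topology

lemma mFourierCoeff_eq_integral_torusMeasure (f : UnitAddTorus (Fin d) → ℂ) (n : Fin d → ℤ) :
    UnitAddTorus.mFourierCoeff f n =
      ∫ x, UnitAddTorus.mFourier (-n) x * f x ∂(torusMeasure d) := rfl

lemma integrable_continuousMap_mul (φ : C(UnitAddTorus (Fin d), ℂ)) {h : UnitAddTorus (Fin d) → ℂ}
    (hh : Integrable h (torusMeasure d)) : Integrable (fun x => φ x * h x) (torusMeasure d) :=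
  hh.bdd_mul φ.continuous.aestronglyMeasurable (ae_of_all _ φ.norm_coe_le_norm)

/-- An integrable function on the torus is determined by its Fourier coefficients. -/
lemma ae_eq_zero_of_mFourierCoeff_eq_zero {h : UnitAddTorus (Fin d) → ℂ}
    (hh : Integrable h (torusMeasure d)) (h0 : ∀ n, UnitAddTorus.mFourierCoeff h n = 0) :
    h =ᵐ[torusMeasure d] 0 := by
  let Λ : C(UnitAddTorus (Fin d), ℂ) →L[ℂ] ℂ := LinearMap.mkContinuous
    { toFun := fun φ => ∫ x, φ x * h x ∂(torusMeasure d)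
      map_add' := fun φ ψ => by
        simp_rw [ContinuousMap.add_apply, add_mul]
        exact integral_add (integrable_continuousMap_mul φ hh) (integrable_continuousMap_mul ψ hh)
      map_smul' := fun c φ => by
        simp_rw [ContinuousMap.smul_apply, smul_eq_mul, mul_assoc, integral_const_mul]; rfl }
    (∫ x, ‖h x‖ ∂(torusMeasure d)) (fun φ => by
      change ‖∫ x, φ x * h x ∂(torusMeasure d)‖ ≤ _
      rw [mul_comm, ← integral_const_mul]
      refine norm_integral_le_of_norm_le (hh.norm.const_mul _) (ae_of_all _ fun x => ?_)
      rw [norm_mul]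
      gcongr
      exact φ.norm_coe_le_norm x)
  -- Integration against `h` is continuous in the uniform norm and kills the characters, whose span
  -- is dense.
  have hΛ : ∀ φ : C(UnitAddTorus (Fin d), ℂ), ∫ x, φ x * h x ∂(torusMeasure d) = 0 := by
    intro φ
    have hker : (Submodule.span ℂ (Set.range <| UnitAddTorus.mFourier (d := Fin d))).topologicalClosure
        ≤ Λ.ker := by
      refine Submodule.topologicalClosure_minimal _ (Submodule.span_le.2 ?_) Λ.isClosed_ker
      rintro _ ⟨n, rfl⟩
      have := h0 (-n)
      rw [mFourierCoeff_eq_integral_torusMeasure, neg_neg] at this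
      exact this
    rw [UnitAddTorus.span_mFourier_closure_eq_top] at hker
    exact hker (Submodule.mem_top : φ ∈ ⊤)
  -- Indicators of closed sets are bounded pointwise limits of continuous functions, so `h` has zero
  -- integral over each closed set.
  refine ae_eq_zero_of_forall_setIntegral_isClosed_eq_zero hh fun s hs => ?_
  have hδ : ∀ n : ℕ, (0 : ℝ) < 1 / ((n : ℝ) + 1) := fun n => by positivity
  have hlim := thickenedIndicator_tendsto_indicator_closure hδ
    tendsto_one_div_add_atTop_nhds_zero_nat s
  rw [hs.closure_eq, tendsto_pi_nhds] at hlim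
  have hconv : Tendsto (fun n : ℕ => ∫ x, ((thickenedIndicator (hδ n) s x : ℝ) : ℂ) * h x
      ∂(torusMeasure d)) atTop (𝓝 (∫ x, s.indicator h x ∂(torusMeasure d))) := by
    refine tendsto_integral_of_dominated_convergence (fun x => ‖h x‖) (fun n => ?_) hh.norm
      (fun n => ae_of_all _ fun x => ?_) (ae_of_all _ fun x => ?_)
    · exact (by fun_prop : Continuous fun x => ((thickenedIndicator (hδ n) s x : ℝ) : ℂ)
        ).aestronglyMeasurable.mul hh.aestronglyMeasurable
    · rw [norm_mul, Complex.norm_real, NNReal.norm_eq]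
      exact mul_le_of_le_one_left (norm_nonneg _) (by exact_mod_cast thickenedIndicator_le_one _ _ _)
    · have h1 : Tendsto (fun n : ℕ => ((thickenedIndicator (hδ n) s x : ℝ) : ℂ)) atTop
          (𝓝 (((s.indicator (fun _ => (1 : NNReal)) x : NNReal) : ℝ) : ℂ)) :=
        (Complex.continuous_ofReal.comp NNReal.continuous_coe).continuousAt.tendsto.comp (hlim x)
      have h2 := h1.mul_const (h x)
      by_cases hx : x ∈ s <;> simpa [hx] using h2
  rw [← integral_indicator hs.measurableSet]
  refine tendsto_nhds_unique hconv ?_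
  have : ∀ n : ℕ, ∫ x, ((thickenedIndicator (hδ n) s x : ℝ) : ℂ) * h x ∂(torusMeasure d) = 0 :=
    fun n => hΛ ⟨fun x => ((thickenedIndicator (hδ n) s x : ℝ) : ℂ), by fun_prop⟩
  simp_rw [this]
  exact tendsto_const_nhds

/-- The frequencies all of whose coordinates lie in the first `N` dyadic blocks. -/
noncomputable def box (d N : ℕ) : Finset (Fin d → ℤ) :=
  Fintype.piFinset fun _ => (Finset.range N).biUnion dyadicBlock

lemma mem_box {N : ℕ} {n : Fin d → ℤ} : n ∈ box d N ↔ ∀ j, (n j).natAbs.size < N := by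
  simp [box, mem_dyadicBlock]

lemma tendsto_box (d : ℕ) : Tendsto (box d) atTop atTop := by
  refine tendsto_atTop_finset_of_monotone (fun N M hNM n hn => ?_) (fun n => ?_)
  · rw [mem_box] at hn ⊢
    exact fun j => (hn j).trans_le hNM
  · refine ⟨∑ j, (n j).natAbs.size + 1, mem_box.2 fun j => Nat.lt_succ_of_le ?_⟩
    exact Finset.single_le_sum (f := fun j => (n j).natAbs.size) (fun _ _ => Nat.zero_le _)
      (Finset.mem_univ j)

/-- The `N`-th partial sum of the Fourier series over dyadic boxes. -/
noncomputable def boxSum (f : UnitAddTorus (Fin d) → ℂ) (N : ℕ) : C(UnitAddTorus (Fin d), ℂ) :=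
  trigPoly (box d N) (UnitAddTorus.mFourierCoeff f)

/-- The localised pieces of a box sum are rough projections, and on a probability space their `L^p`
norms are at most their `L^∞` norms. -/
lemma exists_lpNorm_boxSum_sq_le (d : ℕ) : ∃ C : ℝ, 0 < C ∧ ∀ (m N : ℕ)
    (f : UnitAddTorus (Fin d) → ℂ), roughSquareSum f < ∞ →
      lpNorm m (boxSum f N) ^ 2 ≤ (C * (m + 1)) ^ d * (roughSquareSum f).toReal := by
  obtain ⟨C, hC, h⟩ := exists_lpNorm_sq_le_sum d
  refine ⟨C, hC, fun m N f hf => ?_⟩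
  refine (h m N (box d N) _ fun n hn j => mem_box.1 hn j).trans ?_
  refine mul_le_mul_of_nonneg_left ?_ (by positivity)
  rw [← ENNReal.ofReal_le_iff_le_toReal hf.ne, ENNReal.ofReal_sum_of_nonneg fun _ _ => sq_nonneg _,
    roughSquareSum]
  have hinj : Function.Injective fun (k : Fin d → Fin N) (i : Fin d) => (k i : ℕ) :=
    fun k l hkl => funext fun i => Fin.ext (congrFun hkl i)
  refine le_trans ?_ (ENNReal.tsum_comp_le_tsum_of_injective hinj _)
  rw [tsum_fintype]
  refine Finset.sum_le_sum fun k _ => ?_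
  rw [ENNReal.ofReal_pow (lpNorm_nonneg _ _)]
  gcongr
  have hF : (box d N).filter (fun n => ∀ i, (n i).natAbs.size = (k i : ℕ)) =
      Fintype.piFinset fun i => dyadicBlock (k i) := by
    ext n
    simp only [Finset.mem_filter, mem_box, Fintype.mem_piFinset, mem_dyadicBlock]
    exact ⟨fun h => h.2, fun h => ⟨fun i => (h i).trans_lt (k i).2, h⟩⟩
  rw [hF, ofReal_lpNorm_eq_eLpNorm]
  have hfun : ⇑(trigPoly (Fintype.piFinset fun i => dyadicBlock (k i)) (UnitAddTorus.mFourierCoeff f)) =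
      roughProjection (fun i => (k i : ℕ)) f := funext fun x => trigPoly_apply _ _ x
  rw [← hfun]
  exact eLpNorm_le_eLpNorm_of_exponent_le le_top (ContinuousMap.continuous _).aestronglyMeasurable

lemma _root_.Orthonormal.norm_sq_sum_smul {ι E : Type*} [NormedAddCommGroup E]
    [InnerProductSpace ℂ E] {v : ι → E} (hv : Orthonormal ℂ v) (l : ι → ℂ) (s : Finset ι) :
    ‖∑ i ∈ s, l i • v i‖ ^ 2 = ∑ i ∈ s, ‖l i‖ ^ 2 := by
  have h := hv.inner_sum l l s
  rw [inner_self_eq_norm_sq_to_K] at h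
  have h2 : ∀ i ∈ s, (starRingEnd ℂ) (l i) * l i = ((‖l i‖ ^ 2 : ℝ) : ℂ) := fun i _ => by
    rw [mul_comm, Complex.mul_conj, Complex.normSq_eq_norm_sq]
  rw [Finset.sum_congr rfl h2] at h
  apply Complex.ofReal_injective
  push_cast at h ⊢
  exact h

lemma sum_norm_sq_mFourierCoeff_eq (f : UnitAddTorus (Fin d) → ℂ) (N : ℕ) :
    ∑ n ∈ box d N, ‖UnitAddTorus.mFourierCoeff f n‖ ^ 2 = lpNorm 0 (boxSum f N) ^ 2 := by
  have h1 : lpNorm 0 (boxSum f N) =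
      ‖ContinuousMap.toLp (E := ℂ) 2 (torusMeasure d) ℂ (boxSum f N)‖ := by
    rw [lpNorm, Lp.norm_def, Lp.norm_def, eLpNorm_congr_ae (ContinuousMap.coeFn_toLp _ _),
      eLpNorm_congr_ae (ContinuousMap.coeFn_toLp _ _)]
    simp [evenExp]
  rw [h1, boxSum, trigPoly, map_sum]
  simp_rw [map_smul]
  have h2 := Orthonormal.norm_sq_sum_smul (UnitAddTorus.orthonormal_mFourier (d := Fin d))
    (UnitAddTorus.mFourierCoeff f) (box d N)
  exact h2.symm

/-- Along a subsequence the box partial sums converge almost everywhere. -/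
lemma exists_subseq_boxSum_tendsto_ae {f : UnitAddTorus (Fin d) → ℂ}
    (hf : Integrable f (torusMeasure d)) {B : ℝ} (hB : ∀ N, lpNorm 0 (boxSum f N) ^ 2 ≤ B) :
    ∃ φ : ℕ → ℕ, ∀ᵐ x ∂(torusMeasure d),
      Tendsto (fun i => boxSum f (φ i) x) atTop (𝓝 (f x)) := by
  have hsum : Summable fun n => ‖UnitAddTorus.mFourierCoeff f n‖ ^ 2 := by
    refine summable_of_sum_le (c := B) (fun n => by positivity) fun s => ?_
    obtain ⟨N, hN⟩ := ((tendsto_box d).eventually (eventually_ge_atTop s)).exists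
    exact (Finset.sum_le_sum_of_subset_of_nonneg hN fun _ _ _ => by positivity).trans
      ((sum_norm_sq_mFourierCoeff_eq f N).le.trans (hB N))
  -- Riesz–Fischer: an `L²` function with the coefficients of `f`, equal to `f` almost everywhere by
  -- uniqueness in `L¹`.
  let a : lp (fun _ : Fin d → ℤ => ℂ) 2 := ⟨UnitAddTorus.mFourierCoeff f, memℓp_gen (by simpa using hsum)⟩
  let g : Lp ℂ 2 (torusMeasure d) := (UnitAddTorus.mFourierBasis (d := Fin d)).repr.symm a
  have hg : HasSum (fun n => UnitAddTorus.mFourierCoeff f n •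
      ContinuousMap.toLp (E := ℂ) 2 (torusMeasure d) ℂ (UnitAddTorus.mFourier n)) g := by
    have := (UnitAddTorus.mFourierBasis (d := Fin d)).hasSum_repr_symm a
    rw [UnitAddTorus.coe_mFourierBasis] at this
    exact this
  have hcoef : ∀ n, UnitAddTorus.mFourierCoeff g n = UnitAddTorus.mFourierCoeff f n := by
    intro n
    have h1 := UnitAddTorus.mFourierBasis_repr g n
    rw [← h1]
    change (UnitAddTorus.mFourierBasis (d := Fin d)).repr
      ((UnitAddTorus.mFourierBasis (d := Fin d)).repr.symm a) n = _
    rw [LinearIsometryEquiv.apply_symm_apply]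
  have hgi : Integrable g (torusMeasure d) :=
    (Lp.memLp g).integrable (by norm_num)
  have hgf : (fun x => g x - f x) =ᵐ[torusMeasure d] 0 := by
    refine ae_eq_zero_of_mFourierCoeff_eq_zero (hgi.sub hf) fun n => ?_
    rw [mFourierCoeff_eq_integral_torusMeasure]
    simp_rw [mul_sub]
    rw [integral_sub (integrable_continuousMap_mul _ hgi) (integrable_continuousMap_mul _ hf),
      ← mFourierCoeff_eq_integral_torusMeasure, ← mFourierCoeff_eq_integral_torusMeasure, hcoef,
      sub_self]
  have hT : Tendsto (fun N => ContinuousMap.toLp (E := ℂ) 2 (torusMeasure d) ℂ (boxSum f N)) atTop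
      (𝓝 g) := by
    refine (hg.comp (tendsto_box d)).congr fun N => ?_
    simp only [Function.comp_apply, boxSum, trigPoly, map_sum, map_smul]
  obtain ⟨φ, -, hφ⟩ := (tendstoInMeasure_of_tendsto_Lp hT).exists_seq_tendsto_ae
  refine ⟨φ, ?_⟩
  have hall : ∀ᵐ x ∂(torusMeasure d), ∀ N,
      ContinuousMap.toLp (E := ℂ) 2 (torusMeasure d) ℂ (boxSum f N) x = boxSum f N x :=
    ae_all_iff.2 fun N => ContinuousMap.coeFn_toLp _ _
  filter_upwards [hφ, hall, hgf] with x h1 h2 h3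
  simp_rw [h2] at h1
  rwa [sub_eq_zero.1 h3] at h1

/-! ### From moments to exponential integrability -/

lemma ofReal_exp_eq_tsum {y : ℝ} (hy : 0 ≤ y) :
    ENNReal.ofReal (Real.exp y) = ∑' n : ℕ, ENNReal.ofReal (y ^ n / n.factorial) := by
  rw [← ENNReal.ofReal_tsum_of_nonneg (fun n => by positivity) (Real.summable_pow_div_factorial y),
    Real.exp_eq_exp_ℝ, (NormedSpace.expSeries_div_hasSum_exp y).tsum_eq]

/-- Hölder against the constant `1` on a probability space. It reduces the fractional moments of
order `2n/d` to the even moments of order `2n`. -/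
lemma lintegral_ofReal_rpow_le (hd : 1 ≤ d) {F : UnitAddTorus (Fin d) → ℝ} (hF : Continuous F)
    (hF0 : ∀ x, 0 ≤ F x) {B : ℝ} (hB0 : 0 ≤ B)
    (hB : ∫ x, F x ^ d ∂(torusMeasure d) ≤ B ^ d) :
    ∫⁻ x, ENNReal.ofReal (F x) ∂(torusMeasure d) ≤ ENNReal.ofReal B := by
  have hd' : (1 : ℝ) ≤ d := by exact_mod_cast hd
  have hd0 : (d : ℝ) ≠ 0 := by positivity
  have h1 := ENNReal.lintegral_mul_norm_pow_le (μ := torusMeasure d)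
    (f := fun x => ENNReal.ofReal (F x ^ d)) (g := fun _ => 1)
    (by fun_prop) (by fun_prop) (p := 1 / d) (q := 1 - 1 / d) (by positivity)
    (by rw [sub_nonneg, div_le_one (by positivity)]; exact hd') (by ring)
  have hroot : ∀ y : ℝ, 0 ≤ y → ENNReal.ofReal (y ^ d) ^ (1 / d : ℝ) = ENNReal.ofReal y := by
    intro y hy
    rw [ENNReal.ofReal_rpow_of_nonneg (by positivity) (by positivity), ← Real.rpow_natCast,
      ← Real.rpow_mul hy, mul_one_div_cancel hd0, Real.rpow_one]
  simp only [ENNReal.one_rpow, mul_one, lintegral_one, measure_univ] at h1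
  simp_rw [fun x => hroot (F x) (hF0 x)] at h1
  refine h1.trans ?_
  rw [← hroot B hB0, ← ofReal_integral_eq_lintegral_ofReal (integrable_continuousMap (by fun_prop))
    (ae_of_all _ fun x => pow_nonneg (hF0 x) d)]
  gcongr

/-- Exponential integrability from growth of the even moments. -/
lemma lintegral_exp_le_two (hd : 1 ≤ d) (g : C(UnitAddTorus (Fin d), ℂ)) {s C : ℝ} (hs : 0 < s)
    (hC : 0 < C) (hg : ∀ m, lpNorm m g ^ 2 ≤ (C * (m + 1)) ^ d * s ^ 2) :
    ∫⁻ x, ENNReal.ofReal (Real.exp (1 / (2 * Real.exp 1 * C) * (‖g x‖ / s) ^ (2 / (d : ℝ))))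
      ∂(torusMeasure d) ≤ 2 := by
  have hd' : (0 : ℝ) < d := by exact_mod_cast hd
  -- Chosen so that `c C e = 1/2`: the `n`-th term of the exponential series is then at most
  -- `2^(-n)`.
  set c := 1 / (2 * Real.exp 1 * C) with hc
  have hc0 : 0 < c := by positivity
  set Y : UnitAddTorus (Fin d) → ℝ := fun x => (‖g x‖ / s) ^ (2 / (d : ℝ)) with hY
  have hY0 : ∀ x, 0 ≤ Y x := fun x => by positivity
  have hYc : Continuous Y :=
    Continuous.rpow_const (by fun_prop) fun x => Or.inr (by positivity)
  have hYd : ∀ x, Y x ^ d = (‖g x‖ / s) ^ 2 := fun x => by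
    rw [hY, ← Real.rpow_natCast, ← Real.rpow_mul (by positivity), div_mul_cancel₀ _ hd'.ne']
    exact_mod_cast Real.rpow_natCast _ 2
  have hexp : ∀ x, ENNReal.ofReal (Real.exp (c * (‖g x‖ / s) ^ (2 / (d : ℝ)))) =
      ∑' n : ℕ, ENNReal.ofReal ((c * Y x) ^ n / n.factorial) :=
    fun x => ofReal_exp_eq_tsum (mul_nonneg hc0.le (hY0 x))
  simp_rw [hexp]
  rw [lintegral_tsum fun n => (by fun_prop :
    Continuous fun x => (c * Y x) ^ n / (n.factorial : ℝ)).measurable.ennreal_ofReal.aemeasurable, ← ENNReal.tsum_geometric_two]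
  refine ENNReal.tsum_le_tsum fun n => ?_
  have h1 : ∫⁻ x, ENNReal.ofReal ((c * Y x) ^ n / n.factorial) ∂(torusMeasure d) ≤
      ENNReal.ofReal (c ^ n / n.factorial * (C * n) ^ n) := by
    refine lintegral_ofReal_rpow_le hd (by fun_prop)
      (fun x => by have := hY0 x; positivity) (by positivity) ?_
    have e1 : ∀ x, ((c * Y x) ^ n / n.factorial) ^ d =
        (c ^ n / n.factorial) ^ d / (s ^ 2) ^ n * ‖g x‖ ^ (2 * n) := fun x => by
      have : (Y x ^ n) ^ d = (‖g x‖ ^ 2 / s ^ 2) ^ n := by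
        rw [← pow_mul, mul_comm, pow_mul, hYd, div_pow]
      rw [mul_pow, mul_div_right_comm, mul_pow, this, div_pow (‖g x‖ ^ 2), ← pow_mul ‖g x‖]
      ring
    simp_rw [e1]
    rw [integral_const_mul, mul_pow]
    -- The moment of order `2n` is the norm `lpNorm m` with `m = n - 1`; the term `n = 0` is
    -- trivial.
    rcases n with _ | m
    · simp
    · rw [← lpNorm_pow, pow_mul (lpNorm m g)]
      have h2 : (lpNorm m g ^ 2) ^ (m + 1) ≤ ((C * (m + 1)) ^ d * s ^ 2) ^ (m + 1) := by
        gcongr; exact hg m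
      calc _ ≤ (c ^ (m + 1) / (m + 1).factorial) ^ d / (s ^ 2) ^ (m + 1) *
            ((C * (m + 1)) ^ d * s ^ 2) ^ (m + 1) := by gcongr
        _ = _ := by
          have hs' : (s ^ 2) ^ (m + 1) ≠ 0 := by positivity
          have e3 : ((C * ((m : ℝ) + 1)) ^ d) ^ (m + 1) = ((C * ((m + 1 : ℕ) : ℝ)) ^ (m + 1)) ^ d := by
            push_cast
            rw [← pow_mul, ← pow_mul, mul_comm d]
          rw [mul_pow (_ ^ d), e3, div_mul_eq_mul_div, ← mul_assoc, mul_div_assoc, div_self hs',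
            mul_one]
  refine h1.trans ?_
  have h3 : c ^ n / n.factorial * (C * n) ^ n ≤ (1 / 2 : ℝ) ^ n := by
    have h4 : (n : ℝ) ^ n / n.factorial ≤ Real.exp n :=
      Real.pow_div_factorial_le_exp _ (by positivity) n
    have h5 : Real.exp n = Real.exp 1 ^ n := by rw [← Real.exp_nat_mul, mul_one]
    calc c ^ n / n.factorial * (C * n) ^ n = (c * C) ^ n * ((n : ℝ) ^ n / n.factorial) := by
          rw [mul_pow, mul_pow]; ring
      _ ≤ (c * C) ^ n * Real.exp 1 ^ n := by rw [← h5]; gcongr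
      _ = _ := by
        rw [← mul_pow, hc]; congr 1; field_simp
  refine (ENNReal.ofReal_le_ofReal h3).trans ?_
  rw [ENNReal.ofReal_pow (by norm_num), one_div, ENNReal.ofReal_inv_of_pos (by norm_num),
    ENNReal.ofReal_ofNat]

end RoughLP

theorem mainTheorem4 (d : ℕ) (hd : 1 ≤ d) :
    ∃ c₁ c₂ : ℝ, 0 < c₁ ∧ 0 < c₂ ∧
      ∀ f : UnitAddTorus (Fin d) → ℂ, Integrable f (RoughLP.torusMeasure d) →
        RoughLP.roughSquareSum f < ∞ →
        ∫⁻ x, ENNReal.ofReal (Real.exp (c₁ *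
            (‖f x‖ / Real.sqrt (RoughLP.roughSquareSum f).toReal) ^ (2 / (d : ℝ))))
          ∂(RoughLP.torusMeasure d) < ENNReal.ofReal c₂ := by
  obtain ⟨C, hC, hbound⟩ := RoughLP.exists_lpNorm_boxSum_sq_le d
  have hd' : (0 : ℝ) < d := by exact_mod_cast hd
  -- The integral is at most `2`; the value `3` makes the inequality strict.
  refine ⟨1 / (2 * Real.exp 1 * C), 3, by positivity, by norm_num, fun f hf hS => ?_⟩
  rw [ENNReal.ofReal_ofNat]
  set s := Real.sqrt (RoughLP.roughSquareSum f).toReal with hs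
  -- When `s = 0`, division by zero gives `0`, so the integrand is identically `1`.
  rcases (show 0 ≤ s from Real.sqrt_nonneg _).eq_or_lt with hs0 | hs0
  · rw [← hs0]
    simp only [div_zero, Real.zero_rpow (by positivity : 2 / (d : ℝ) ≠ 0), mul_zero, Real.exp_zero,
      ENNReal.ofReal_one, lintegral_one, measure_univ]
    norm_num
  · have hs2 : s ^ 2 = (RoughLP.roughSquareSum f).toReal := Real.sq_sqrt ENNReal.toReal_nonneg
    obtain ⟨φ, hφ⟩ := RoughLP.exists_subseq_boxSum_tendsto_ae hf fun N => hbound 0 N f hS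
    set Φ : ℂ → ℝ≥0∞ := fun z => ENNReal.ofReal (Real.exp (1 / (2 * Real.exp 1 * C) *
      (‖z‖ / s) ^ (2 / (d : ℝ)))) with hΦ
    have hΦc : Continuous Φ := by
      have : Continuous fun z : ℂ => (‖z‖ / s) ^ (2 / (d : ℝ)) :=
        Continuous.rpow_const (by fun_prop) fun x => Or.inr (by positivity)
      exact ENNReal.continuous_ofReal.comp (Real.continuous_exp.comp (continuous_const.mul this))
    have hle : ∫⁻ x, Φ (f x) ∂(RoughLP.torusMeasure d) ≤ 2 := by
      -- Fatou's lemma along the convergent subsequence; the bound for the partial sums is uniform.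
      calc _ ≤ ∫⁻ x, Filter.liminf (fun i => Φ (RoughLP.boxSum f (φ i) x)) Filter.atTop
            ∂(RoughLP.torusMeasure d) := by
            refine lintegral_mono_ae ?_
            filter_upwards [hφ] with x hx
            exact ((hΦc.tendsto _).comp hx).liminf_eq.ge
        _ ≤ Filter.liminf (fun i => ∫⁻ x, Φ (RoughLP.boxSum f (φ i) x) ∂(RoughLP.torusMeasure d)) Filter.atTop :=
            lintegral_liminf_le fun i => (hΦc.comp (ContinuousMap.continuous _)).measurable
        _ ≤ 2 := by
            refine Filter.liminf_le_of_le (by isBoundedDefault) fun b hb => ?_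
            obtain ⟨i, hi⟩ := hb.exists
            refine hi.trans (RoughLP.lintegral_exp_le_two hd _ hs0 hC fun m => ?_)
            rw [hs2]
            exact hbound m _ f hS
    exact hle.trans_lt (by norm_num)
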